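/- Let $E$ be the elliptic curve $y^2 = x(x+3)(x-1)$ over $\mathbb{Q}$. For a number field $K$, a non-constant arithmetic progression of four squares over $K$ is a sequence $(q_0,q_1,q_2,q_3)\in K^4$ of squares in $K$ with $q_1-q_0=q_2-q_1=q_3-q_2\neq 0$; two such progressions are identified if they are proportional, i.e. differ by a common factor in $K^\times$. By a cyclic cubic number field we mean a Galois extension of $\mathbb{Q}$ of degree $3$ with cyclic Galois group; such fields are counted up to isomorphism (equivalently, as subfields of a fixed algebraic closure of $\mathbb{Q}$). Theorem. There are infinitely many cyclic cubic number fields $K$ in each of which there exist infinitely many (pairwise non-proportional) non-constant arithmetic progressions of four squares. Equivalently, there are infinitely many cyclic cubic number fields $K$ with $\operatorname{rank} E(K)>0$; indeed, for every cyclic cubic number field $K$, there are infinitely many such progressions over $K$ if and only if $\operatorname{rank} E(K)>0$. -/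

import Mathlib

namespace FourSquares

/-- `q 0, q 1, q 2, q 3` is a non-constant arithmetic progression in `K`
all of whose terms are squares in `K`. -/
structure IsProgression {K : Type*} [Field K] (q : Fin 4 → K) : Prop where
  isSquare : ∀ i, IsSquare (q i)
  diff_one : q 1 - q 0 = q 2 - q 1
  diff_two : q 2 - q 1 = q 3 - q 2
  nonconst : q 1 ≠ q 0

/-- The non-constant arithmetic progressions of four squares over `K`, two progressions being
identified when one is obtained from the other by multiplying all terms with a nonzero constant. -/
def progressions (K : Type*) [Field K] : Set (Projectivization K (Fin 4 → K)) :=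
  {P | ∃ (q : Fin 4 → K) (hq : q ≠ 0), IsProgression q ∧ P = Projectivization.mk K q hq}

/-- The curve `y ^ 2 = x * (x + 3) * (x - 1)`, that is, `y ^ 2 = x ^ 3 + 2 * x ^ 2 - 3 * x`,
over `K`. -/
def curveE (K : Type*) [Field K] : WeierstrassCurve K :=
  { a₁ := 0, a₂ := 2, a₃ := 0, a₄ := -3, a₆ := 0 }

theorem curveE_equation_iff {K : Type*} [Field K] (x y : K) :
    (curveE K).toAffine.Equation x y ↔ y ^ 2 = x * (x + 3) * (x - 1) := by
  rw [WeierstrassCurve.Affine.equation_iff]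
  simp only [curveE]
  constructor <;> intro h <;> linear_combination h

instance curveE_isElliptic (K : Type*) [Field K] [CharZero K] : (curveE K).IsElliptic where
  isUnit := by
    have h : (curveE K).Δ = 2304 := by
      simp only [curveE, WeierstrassCurve.Δ, WeierstrassCurve.b₂, WeierstrassCurve.b₄,
        WeierstrassCurve.b₆, WeierstrassCurve.b₈]
      ring
    rw [h, isUnit_iff_ne_zero]
    norm_num

open scoped Classical in
/-- The rank of the Mordell-Weil group of the curve over `K`, as a cardinal number. -/
noncomputable def rankE (K : Type*) [Field K] : Cardinal :=
  Module.rank ℤ (curveE K).toAffine.Point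

/-- `K` is a cyclic cubic number field: a Galois extension of `ℚ` of degree `3`
with cyclic Galois group. -/
structure IsCyclicCubic (K : Type*) [Field K] [Algebra ℚ K] : Prop where
  degree : Module.finrank ℚ K = 3
  isGalois : IsGalois ℚ K
  isCyclic : IsCyclic (K ≃ₐ[ℚ] K)

end FourSquares

/-! A non-constant progression is proportional to `t, t + 1, t + 2, t + 3`, and `x = 6 / t + 3`
turns it into a point of E. Conversely, if Q has infinite order, the points `(3, 6) + 2jQ` give
progressions for almost all j, because `x`, `x + 3`, `x - 1` are squares at a double. Torsion over a
number field is finite by heights, so infinitely many progressions means positive rank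
(`infinite_progressions_iff`).

To produce fields, cut E with the lines `y = x + n`. The intersection has its first coordinates at
the roots of a cubic, which generates a cyclic cubic field when it is irreducible and its
discriminant is a nonzero square. Square discriminant is a genus one condition on n; with `n + 1 = 8
/ x` it becomes `fiberCurve`, on which `(2, 6)` has infinite order. At `n = -1` the line passes
through `(1, 0)` and is tangent at `(-1, -2)`, and the cubic has the simple root 1. For n
sufficiently close to -1 in ℚ_p that root persists by Hensel, so the field embeds in ℚ_p
(`exists_padic_root`). By compactness, a multiple of `(2, 6)` is close to infinity, hence n close to
-1, at all primes of a given finite set S and at 2.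

At 2, some root is close to 1 without equalling it; doubling its point lands in the kernel of
reduction, which has no torsion. Hence the rank is positive. The same argument over ℚ makes the
cubic irreducible, since a 2-descent shows that E(ℚ) is torsion (`isOfFinAddOrder_rat`).

Finally, a cyclic cubic field has a ramified prime p and no embedding in ℚ_p. If the list of fields
were finite, take S to contain one such prime for each: the field built from S cannot be on the
list. -/

namespace FourSquares

open WeierstrassCurve WeierstrassCurve.Affine

/-! ### Explicit group law when `a₁ = a₃ = 0` -/

section GroupLaw

variable {F : Type*} [Field F] {W : WeierstrassCurve F}

theorem neg_some_eq (h₁ : W.a₁ = 0) (h₃ : W.a₃ = 0) {x y : F} (h : W.toAffine.Nonsingular x y) :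
    ∃ h', -Point.some x y h = Point.some x (-y) h' := by
  have e : W.toAffine.negY x y = -y := by simp [negY, h₁, h₃]
  refine ⟨e ▸ (nonsingular_neg ..).mpr h, ?_⟩
  rw [Point.neg_some, Point.some.injEq]
  exact ⟨rfl, e⟩

theorem equation_iff_of_short (h₁ : W.a₁ = 0) (h₃ : W.a₃ = 0) {x y : F} :
    W.toAffine.Equation x y ↔ y ^ 2 = x ^ 3 + W.a₂ * x ^ 2 + W.a₄ * x + W.a₆ := by
  rw [equation_iff, h₁, h₃]
  simp

variable [DecidableEq F]

theorem add_some_of_X_ne (h₁ : W.a₁ = 0) (h₃ : W.a₃ = 0) {x₁ y₁ x₂ y₂ : F}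
    (hP : W.toAffine.Nonsingular x₁ y₁) (hQ : W.toAffine.Nonsingular x₂ y₂) (hx : x₁ ≠ x₂) :
    ∃ x₃ y₃ h, Point.some x₁ y₁ hP + Point.some x₂ y₂ hQ = Point.some x₃ y₃ h ∧
      x₃ = ((y₁ - y₂) / (x₁ - x₂)) ^ 2 - W.a₂ - x₁ - x₂ ∧
      y₃ = -((y₁ - y₂) / (x₁ - x₂) * (x₃ - x₁) + y₁) := by
  refine ⟨_, _, _, Point.add_of_X_ne hx, ?_, ?_⟩
  · simp [addX, slope_of_X_ne hx, h₁]
  · simp [addY, negAddY, negY, addX, slope_of_X_ne hx, h₁, h₃]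

theorem add_self_of_Y_ne_zero (h₁ : W.a₁ = 0) (h₃ : W.a₃ = 0) (h2 : (2 : F) ≠ 0) {x y : F}
    (hP : W.toAffine.Nonsingular x y) (hy : y ≠ 0) :
    ∃ x₃ y₃ h, Point.some x y hP + Point.some x y hP = Point.some x₃ y₃ h ∧
      x₃ = ((3 * x ^ 2 + 2 * W.a₂ * x + W.a₄) / (2 * y)) ^ 2 - W.a₂ - 2 * x ∧
      y₃ = -((3 * x ^ 2 + 2 * W.a₂ * x + W.a₄) / (2 * y) * (x₃ - x) + y) := by
  have hy' : y ≠ W.toAffine.negY x y := by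
    intro h
    simp only [negY, h₁, h₃, zero_mul, sub_zero] at h
    have : 2 * y = 0 := by linear_combination h
    exact (mul_ne_zero h2 hy) this
  have e : W.toAffine.slope x x y y = (3 * x ^ 2 + 2 * W.a₂ * x + W.a₄) / (2 * y) := by
    rw [slope_of_Y_ne rfl hy']
    simp only [negY, h₁, h₃]
    ring_nf
  refine ⟨_, _, _, Point.add_self_of_Y_ne hy', ?_, ?_⟩
  · simp only [addX, e, h₁]
    ring
  · simp only [addY, negAddY, negY, addX, e, h₁, h₃]
    ring

theorem add_self_of_Y_eq_zero (h₁ : W.a₁ = 0) (h₃ : W.a₃ = 0) {x y : F}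
    (hP : W.toAffine.Nonsingular x y) (hy : y = 0) :
    Point.some x y hP + Point.some x y hP = 0 :=
  Point.add_self_of_Y_eq (by simp [negY, h₁, h₃, hy])

end GroupLaw

/-! ### Nonarchimedean estimates -/

section Nonarchimedean

variable {F : Type*} [Field F] {v : AbsoluteValue F ℝ}

theorem abv_add_le_of_le (hv : IsNonarchimedean v) {x y : F} {r : ℝ} (hx : v x ≤ r) (hy : v y ≤ r) :
    v (x + y) ≤ r :=
  (hv x y).trans (max_le hx hy)

theorem abv_sub_le_of_le (hv : IsNonarchimedean v) {x y : F} {r : ℝ} (hx : v x ≤ r) (hy : v y ≤ r) :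
    v (x - y) ≤ r := by
  rw [sub_eq_add_neg]
  exact abv_add_le_of_le hv hx (by rwa [v.map_neg])

theorem abv_add_eq_left (hv : IsNonarchimedean v) {x y : F} (h : v y < v x) :
    v (x + y) = v x := by
  apply le_antisymm
  · exact abv_add_le_of_le hv le_rfl h.le
  · by_contra! hlt
    have : v x ≤ max (v (x + y)) (v y) := by
      have := hv (x + y) (-y)
      rwa [add_neg_cancel_right, v.map_neg] at this
    exact absurd this (not_le.mpr (max_lt hlt h))

theorem abv_natCast_le_one (hv : IsNonarchimedean v) (n : ℕ) : v n ≤ 1 := by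
  induction n with
  | zero => simp
  | succ n ih => push_cast; exact abv_add_le_of_le hv ih v.map_one.le

theorem abv_mul_le_one {x y : F} (hx : v x ≤ 1) (hy : v y ≤ 1) : v (x * y) ≤ 1 := by
  rw [v.map_mul]
  exact mul_le_one₀ hx (v.nonneg _) hy

theorem abv_pow_le_one {x : F} (hx : v x ≤ 1) (n : ℕ) : v (x ^ n) ≤ 1 := by
  rw [map_pow]
  exact pow_le_one₀ (v.nonneg _) hx

end Nonarchimedean

/-! ### The kernel of reduction -/

section Kernel

variable {F : Type*} [Field F] {W : WeierstrassCurve F} {v : AbsoluteValue F ℝ}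

/-- The point reduces to the point at infinity with respect to the absolute value `v`. -/
def ReducesToZero (v : AbsoluteValue F ℝ) : W.toAffine.Point → Prop
  | 0 => True
  | .some x _ _ => 1 < v x

@[simp] theorem reducesToZero_zero : ReducesToZero v (0 : W.toAffine.Point) := trivial

@[simp] theorem reducesToZero_some {x y : F} (h : W.toAffine.Nonsingular x y) :
    ReducesToZero v (Point.some x y h) ↔ 1 < v x := Iff.rfl

theorem reducesToZero_neg {P : W.toAffine.Point} (h : ReducesToZero v P) : ReducesToZero v (-P) := by
  match P with
  | 0 => exact h
  | .some x y hP => exact h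

/-- The equation and the coefficients of a Weierstrass curve `y² = x³ + a₂ x² + a₄ x + a₆`
that is integral with respect to the absolute value `v`. -/
structure IsShortIntegral (W : WeierstrassCurve F) (v : AbsoluteValue F ℝ) : Prop where
  nonarch : IsNonarchimedean v
  a₁ : W.a₁ = 0
  a₃ : W.a₃ = 0
  a₂ : v W.a₂ ≤ 1
  a₄ : v W.a₄ ≤ 1
  a₆ : v W.a₆ ≤ 1

namespace IsShortIntegral

variable (hW : IsShortIntegral W v)
include hW

theorem abv_cubic {x : F} (hx : 1 < v x) : v (x ^ 3 + W.a₂ * x ^ 2 + W.a₄ * x + W.a₆) = v x ^ 3 := by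
  have h0 : 0 < v x := by linarith
  have h2 : v (W.a₂ * x ^ 2) ≤ v x ^ 2 := by
    rw [v.map_mul, map_pow]; exact mul_le_of_le_one_left (by positivity) hW.a₂
  have h12 : v x ≤ v x ^ 2 := by nlinarith
  have h4 : v (W.a₄ * x) ≤ v x ^ 2 := by
    rw [v.map_mul]; exact (mul_le_of_le_one_left h0.le hW.a₄).trans h12
  have h6 : v W.a₆ ≤ v x ^ 2 := hW.a₆.trans (by nlinarith)
  have := abv_add_le_of_le hW.nonarch (abv_add_le_of_le hW.nonarch h2 h4) h6
  rw [add_assoc, add_assoc, ← add_assoc (W.a₂ * x ^ 2), abv_add_eq_left hW.nonarch, map_pow]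
  rw [map_pow]
  exact this.trans_lt (by nlinarith [sq_nonneg (v x)])

theorem abv_Y_sq {x y : F} (h : W.toAffine.Equation x y) (hx : 1 < v x) : v y ^ 2 = v x ^ 3 := by
  rw [← hW.abv_cubic hx, ← (equation_iff_of_short hW.a₁ hW.a₃).mp h, map_pow]

theorem abv_Y_le_one {x y : F} (h : W.toAffine.Equation x y) (hx : v x ≤ 1) : v y ≤ 1 := by
  have : v (y ^ 2) ≤ 1 := by
    rw [(equation_iff_of_short hW.a₁ hW.a₃).mp h]
    exact abv_add_le_of_le hW.nonarch (abv_add_le_of_le hW.nonarch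
      (abv_add_le_of_le hW.nonarch (abv_pow_le_one hx 3) (abv_mul_le_one hW.a₂ (abv_pow_le_one hx 2)))
      (abv_mul_le_one hW.a₄ hx)) hW.a₆
  rw [map_pow] at this
  exact (sq_le_one_iff₀ (v.nonneg _)).mp this

variable [DecidableEq F]

/-- In `x₃ * (x₁ - x₂) ^ 2` no term exceeds `v x₁ ^ 2`: the large coordinates enter at most as `x₁ ^
2` or as `y₁`, of size `v x₁ ^ (3/2)`. Since `v (x₁ - x₂) = v x₁`, the sum has integral first
coordinate. -/
theorem not_reducesToZero_add {B C : W.toAffine.Point} (hB : ReducesToZero v B)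
    (hC : ¬ ReducesToZero v C) : ¬ ReducesToZero v (B + C) := by
  match B, C with
  | 0, C => rwa [zero_add]
  | .some x₁ y₁ h₁, 0 => simp at hC
  | .some x₁ y₁ h₁, .some x₂ y₂ h₂ =>
    simp only [reducesToZero_some, not_lt] at hB hC
    have hx : x₁ ≠ x₂ := fun h => by rw [h] at hB; linarith
    obtain ⟨x₃, y₃, h, e, hx₃, -⟩ := add_some_of_X_ne hW.a₁ hW.a₃ h₁ h₂ hx
    rw [e, reducesToZero_some, not_lt]
    have e₁ := (equation_iff_of_short hW.a₁ hW.a₃).mp h₁.1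
    have e₂ := (equation_iff_of_short hW.a₁ hW.a₃).mp h₂.1
    have hsub : x₁ - x₂ ≠ 0 := sub_ne_zero.mpr hx
    have key : x₃ * (x₁ - x₂) ^ 2 = x₁ ^ 2 * x₂ + x₁ * x₂ ^ 2 + 2 * (W.a₂ * x₂ * x₁) + W.a₄ * x₁
        + W.a₄ * x₂ + 2 * W.a₆ - 2 * (y₁ * y₂) := by
      rw [hx₃]
      field_simp
      linear_combination e₁ + e₂
    have hv : v (x₁ - x₂) = v x₁ := by
      rw [sub_eq_add_neg, abv_add_eq_left hW.nonarch]
      rw [v.map_neg]; linarith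
    have h2 : v 2 ≤ 1 := by simpa using abv_natCast_le_one hW.nonarch 2
    have hy₂ := hW.abv_Y_le_one h₂.1 hC
    have hy₁ : v y₁ ≤ v x₁ ^ 2 := by
      have := hW.abv_Y_sq h₁.1 hB
      refine (sq_le_sq₀ (v.nonneg _) (by positivity)).mp ?_
      rw [this]
      nlinarith [pow_pos (lt_trans one_pos hB) 3]
    have l0 : v x₁ ≤ v x₁ ^ 2 := by nlinarith
    have l1 : 1 ≤ v x₁ ^ 2 := by nlinarith
    have hb : v (x₁ ^ 2 * x₂ + x₁ * x₂ ^ 2 + 2 * (W.a₂ * x₂ * x₁) + W.a₄ * x₁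
        + W.a₄ * x₂ + 2 * W.a₆ - 2 * (y₁ * y₂)) ≤ v x₁ ^ 2 := by
      refine abv_sub_le_of_le hW.nonarch (abv_add_le_of_le hW.nonarch (abv_add_le_of_le hW.nonarch
        (abv_add_le_of_le hW.nonarch (abv_add_le_of_le hW.nonarch (abv_add_le_of_le hW.nonarch
        ?_ ?_) ?_) ?_) ?_) ?_) ?_
      · rw [v.map_mul, map_pow]; exact mul_le_of_le_one_right (by positivity) hC
      · rw [v.map_mul]
        exact (mul_le_of_le_one_right (v.nonneg _) (abv_pow_le_one hC 2)).trans l0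
      · rw [← mul_assoc, v.map_mul]
        exact (mul_le_of_le_one_left (v.nonneg _) (abv_mul_le_one h2 (abv_mul_le_one hW.a₂ hC))).trans l0
      · rw [v.map_mul]
        exact (mul_le_of_le_one_left (v.nonneg _) hW.a₄).trans l0
      · exact (abv_mul_le_one hW.a₄ hC).trans l1
      · exact (abv_mul_le_one h2 hW.a₆).trans l1
      · rw [mul_comm y₁, ← mul_assoc, v.map_mul]
        exact (mul_le_of_le_one_left (v.nonneg _) (abv_mul_le_one h2 hy₂)).trans hy₁
    rw [← key, v.map_mul, map_pow, hv] at hb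
    exact le_of_mul_le_mul_right (by linarith) (by positivity : 0 < v x₁ ^ 2)

/-- Otherwise `A = -B + (A + B)` would lie outside the kernel by the previous lemma. -/
theorem reducesToZero_add {A B : W.toAffine.Point} (hA : ReducesToZero v A)
    (hB : ReducesToZero v B) : ReducesToZero v (A + B) := by
  by_contra hC
  have := hW.not_reducesToZero_add (reducesToZero_neg hB) hC
  rw [add_comm A, neg_add_cancel_left] at this
  exact this hA

theorem reducesToZero_nsmul {A : W.toAffine.Point} (hA : ReducesToZero v A) (n : ℕ) :
    ReducesToZero v (n • A) := by
  induction n with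
  | zero => simp
  | succ n ih => rw [succ_nsmul]; exact hW.reducesToZero_add ih hA

/-- The squared slope of the tangent has size `v x / v 2 ^ 2`, which exceeds `v x` and dominates the
other terms. -/
theorem abv_lt_abv_double (h2 : v 2 < 1) (h20 : (2 : F) ≠ 0) {x y : F}
    (h : W.toAffine.Nonsingular x y) (hx : 1 < v x) :
    ∃ x₃ y₃ h₃, Point.some x y h + Point.some x y h = Point.some x₃ y₃ h₃ ∧ v x < v x₃ := by
  have hy2 := hW.abv_Y_sq h.1 hx
  have hx0 : 0 < v x := by linarith
  have hy : y ≠ 0 := by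
    rintro rfl
    have : 0 < v x ^ 3 := by positivity
    rw [v.map_zero, zero_pow two_ne_zero] at hy2
    linarith
  obtain ⟨x₃, y₃, h₃, e, hx₃, -⟩ := add_self_of_Y_ne_zero hW.a₁ hW.a₃ h20 h hy
  refine ⟨x₃, y₃, h₃, e, ?_⟩
  have hv2 : 0 < v 2 := v.pos h20
  have h3 : v 3 = 1 := by
    have : (3 : F) = 1 + 2 := by norm_num
    rw [this, abv_add_eq_left hW.nonarch, v.map_one]
    rwa [v.map_one]
  have hnum : v (3 * x ^ 2 + 2 * W.a₂ * x + W.a₄) = v x ^ 2 := by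
    have e1 : v (3 * x ^ 2) = v x ^ 2 := by rw [v.map_mul, h3, one_mul, map_pow]
    have e2 : v (2 * W.a₂ * x + W.a₄) ≤ v x := by
      refine abv_add_le_of_le hW.nonarch ?_ (hW.a₄.trans hx.le)
      rw [v.map_mul]
      exact mul_le_of_le_one_left hx0.le (abv_mul_le_one h2.le hW.a₂)
    rw [add_assoc, abv_add_eq_left hW.nonarch, e1]
    rw [e1]
    nlinarith
  set l := (3 * x ^ 2 + 2 * W.a₂ * x + W.a₄) / (2 * y) with hl
  have hvl : v (l ^ 2) = v x / v 2 ^ 2 := by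
    rw [map_pow, hl, map_div₀, hnum, v.map_mul, div_pow, mul_pow, hy2]
    field_simp
  have hgt : v x < v (l ^ 2) := by
    rw [hvl, lt_div_iff₀ (by positivity)]
    have : v 2 ^ 2 < 1 := pow_lt_one₀ hv2.le h2 two_ne_zero
    nlinarith
  have hrest : v (-(W.a₂ + 2 * x)) ≤ v x := by
    rw [v.map_neg]
    refine abv_add_le_of_le hW.nonarch (hW.a₂.trans hx.le) ?_
    rw [v.map_mul]
    exact mul_le_of_le_one_left hx0.le h2.le
  have : x₃ = l ^ 2 + -(W.a₂ + 2 * x) := by rw [hx₃]; ring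
  rw [this, abv_add_eq_left hW.nonarch (hrest.trans_lt hgt)]
  exact hgt

/-- The first coordinates of the points `2 ^ k • A` grow strictly in absolute value, so A has
infinitely many multiples. -/
theorem nsmul_ne_zero_of_reducesToZero (h2 : v 2 < 1) (h20 : (2 : F) ≠ 0) {A : W.toAffine.Point}
    (hA : ReducesToZero v A) (hA0 : A ≠ 0) {n : ℕ} (hn : n ≠ 0) : n • A ≠ 0 := by
  have step : ∀ k : ℕ, ∃ x y h, 2 ^ k • A = Point.some x y h ∧ 1 < v x ∧
      ∃ x' y' h', 2 ^ (k + 1) • A = Point.some x' y' h' ∧ v x < v x' := by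
    intro k
    induction k with
    | zero =>
      match A with
      | 0 => exact absurd rfl hA0
      | .some x y h =>
        obtain ⟨x₃, y₃, h₃, e, hlt⟩ := hW.abv_lt_abv_double h2 h20 h hA
        refine ⟨x, y, h, by simp, hA, x₃, y₃, h₃, ?_, hlt⟩
        rw [← e]; simp [two_nsmul]
    | succ k ih =>
      obtain ⟨x, y, h, -, hx, x', y', h', e', hlt⟩ := ih
      obtain ⟨x₃, y₃, h₃, e, hlt'⟩ := hW.abv_lt_abv_double h2 h20 h' (hx.trans hlt)
      refine ⟨x', y', h', e', hx.trans hlt, x₃, y₃, h₃, ?_, hlt'⟩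
      rw [← e, ← e', pow_succ 2 (k + 1), mul_nsmul, two_nsmul]
  choose x y h e hx x' y' h' e' hlt using step
  have hmono : StrictMono fun k => v (x k) := by
    refine strictMono_nat_of_lt_succ fun k => ?_
    have := (e' k).symm.trans (e (k + 1))
    rw [Point.some.injEq] at this
    rw [← this.1]
    exact hlt k
  intro hzero
  have hfin : IsOfFinAddOrder A := isOfFinAddOrder_iff_nsmul_eq_zero.mpr ⟨n, by omega, hzero⟩
  have hf := hfin.finite_multiples
  have hinj : Function.Injective fun k : ℕ => 2 ^ k • A := by
    intro i j hij
    simp only [e] at hij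
    rw [Point.some.injEq] at hij
    exact hmono.injective (congrArg v hij.1)
  exact Set.infinite_range_of_injective hinj
    (hf.subset (by rintro _ ⟨k, rfl⟩; exact ⟨2 ^ k, rfl⟩))

end IsShortIntegral

end Kernel

end FourSquares

namespace FourSquares

open WeierstrassCurve WeierstrassCurve.Affine

/-! ### The sum-and-difference map on x-coordinates -/

section AddSub

variable {F : Type*} [Field F] {W : WeierstrassCurve F}

theorem addSubMap_eval (h₁ : W.a₁ = 0) (h₃ : W.a₃ = 0) (s t u : F) :
    (fun i => (addSubMap W i).eval ![s, t, u]) =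
      ![s ^ 2 - 2 * W.a₄ * s * u - 4 * W.a₆ * t * u - (4 * W.a₂ * W.a₆ - W.a₄ ^ 2) * u ^ 2,
        2 * t * s + 4 * W.a₂ * s * u + 2 * W.a₄ * t * u + 4 * W.a₆ * u ^ 2,
        t ^ 2 - 4 * s * u] := by
  have b₂ : W.b₂ = 4 * W.a₂ := by simp [WeierstrassCurve.b₂, h₁]
  have b₄ : W.b₄ = 2 * W.a₄ := by simp [WeierstrassCurve.b₄, h₁]
  have b₆ : W.b₆ = 4 * W.a₆ := by simp [WeierstrassCurve.b₆, h₃]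
  have b₈ : W.b₈ = 4 * W.a₂ * W.a₆ - W.a₄ ^ 2 := by simp [WeierstrassCurve.b₈, h₁, h₃]
  ext i
  fin_cases i
  · simp [addSubMap, b₄, b₆, b₈]
  · simp [addSubMap, b₂, b₄, b₆]
  · simp [addSubMap]

variable [DecidableEq F] [W.IsElliptic]

/-- The diagonal case of the next theorem. If `y = 0` the double is 0 as well, and the constant is
supplied by the nonvanishing of `addSubMap`. -/
theorem exists_sym2x_double (h₁ : W.a₁ = 0) (h₃ : W.a₃ = 0) (h2 : (2 : F) ≠ 0) {x y : F}
    (h : W.toAffine.Nonsingular x y) : ∃ c : F, c ≠ 0 ∧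
      (Point.some x y h + Point.some x y h).sym2x 0 =
        c • fun i => (addSubMap W i).eval ((Point.some x y h).sym2x (Point.some x y h)) := by
  have e := (equation_iff_of_short h₁ h₃).mp h.1
  have hne := addSubMap_ne_zero W (Point.sym2x_ne_zero (Point.some x y h) (Point.some x y h))
  rw [Point.sym2x_some_some, addSubMap_eval h₁ h₃] at hne ⊢
  have e2 : (x + x) ^ 2 - 4 * (x * x) * 1 = 0 := by ring
  by_cases hy : y = 0
  · rw [add_self_of_Y_eq_zero h₁ h₃ h hy, Point.sym2x_zero_zero]
    have e1 : 2 * (x + x) * (x * x) + 4 * W.a₂ * (x * x) * 1 + 2 * W.a₄ * (x + x) * 1 +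
        4 * W.a₆ * 1 ^ 2 = 0 := by
      rw [hy] at e
      linear_combination -4 * e
    rw [e1, e2] at hne ⊢
    generalize (x * x) ^ 2 - 2 * W.a₄ * (x * x) * 1 - 4 * W.a₆ * (x + x) * 1 -
      (4 * W.a₂ * W.a₆ - W.a₄ ^ 2) * 1 ^ 2 = f at hne ⊢
    have f0 : f ≠ 0 := by
      rintro rfl
      exact hne (by ext i; fin_cases i <;> rfl)
    exact ⟨f⁻¹, inv_ne_zero f0, by simp [f0]⟩
  · obtain ⟨x₃, y₃, h', e', hx₃, -⟩ := add_self_of_Y_ne_zero h₁ h₃ h2 h hy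
    have h4 : (4 : F) ≠ 0 := by
      rw [show (4 : F) = 2 * 2 by norm_num]; exact mul_ne_zero h2 h2
    refine ⟨(4 * y ^ 2)⁻¹, inv_ne_zero (mul_ne_zero h4 (pow_ne_zero 2 hy)), ?_⟩
    rw [e', Point.sym2x_some_zero, e2]
    rw [Matrix.smul_vec3]
    simp only [smul_eq_mul]
    refine Matrix.vec3_eq ?_ ?_ (mul_zero _).symm
    · rw [hx₃]
      field_simp
      linear_combination (-16 * W.a₂ - 32 * x) * e
    · field_simp
      linear_combination 4 * e

/-- The symmetric functions of `x(P + Q)` and `x(P - Q)` are quadratic forms in those of `x(P)` and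
`x(Q)`; this is what yields the approximate parallelogram law. -/
theorem exists_sym2x_add_sub (h₁ : W.a₁ = 0) (h₃ : W.a₃ = 0) (h2 : (2 : F) ≠ 0)
    (P Q : W.toAffine.Point) : ∃ c : F, c ≠ 0 ∧
      (P + Q).sym2x (P - Q) = c • fun i => (addSubMap W i).eval (P.sym2x Q) := by
  match P, Q with
  | 0, 0 =>
    refine ⟨1, one_ne_zero, ?_⟩
    rw [add_zero, sub_zero, Point.sym2x_zero_zero, addSubMap_eval h₁ h₃, one_smul]
    exact Matrix.vec3_eq (by ring) (by ring) (by ring)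
  | 0, .some x y h =>
    refine ⟨1, one_ne_zero, ?_⟩
    rw [zero_add, zero_sub, Point.sym2x_neg_right, Point.sym2x_zero_some, Point.sym2x_some_some,
      addSubMap_eval h₁ h₃, one_smul]
    exact Matrix.vec3_eq (by ring) (by ring) (by ring)
  | .some x y h, 0 =>
    refine ⟨1, one_ne_zero, ?_⟩
    rw [add_zero, sub_zero, Point.sym2x_some_zero, Point.sym2x_some_some,
      addSubMap_eval h₁ h₃, one_smul]
    exact Matrix.vec3_eq (by ring) (by ring) (by ring)
  | .some x₁ y₁ hP, .some x₂ y₂ hQ =>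
    by_cases hx : x₁ = x₂
    · rcases Point.X_eq_iff.mp hx with h | h
      · rw [h, sub_self]
        exact exists_sym2x_double h₁ h₃ h2 hQ
      · rw [h, neg_add_cancel, Point.sym2x_comm, Point.sym2x_neg_left, sub_eq_add_neg,
          ← neg_add, Point.sym2x_neg_left]
        exact exists_sym2x_double h₁ h₃ h2 hQ
    · obtain ⟨x₃, y₃, h', e', hx₃, -⟩ := add_some_of_X_ne h₁ h₃ hP hQ hx
      obtain ⟨hQ', eQ⟩ := neg_some_eq h₁ h₃ hQ
      obtain ⟨x₄, y₄, h'', e'', hx₄, -⟩ := add_some_of_X_ne h₁ h₃ hP hQ' hx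
      have e₁ := (equation_iff_of_short h₁ h₃).mp hP.1
      have e₂ := (equation_iff_of_short h₁ h₃).mp hQ.1
      have hs := sub_ne_zero.mpr hx
      refine ⟨((x₁ - x₂) ^ 2)⁻¹, inv_ne_zero (pow_ne_zero 2 hs), ?_⟩
      rw [sub_eq_add_neg, eQ, e', e'', Point.sym2x_some_some, Point.sym2x_some_some,
        addSubMap_eval h₁ h₃]
      rw [Matrix.smul_vec3]
      simp only [smul_eq_mul]
      refine Matrix.vec3_eq ?_ ?_ ?_
      · rw [hx₃, hx₄]
        field_simp
        set f₁ := x₁ ^ 3 + W.a₂ * x₁ ^ 2 + W.a₄ * x₁ + W.a₆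
        set f₂ := x₂ ^ 3 + W.a₂ * x₂ ^ 2 + W.a₄ * x₂ + W.a₆
        have E1 : (y₁ - y₂) ^ 2 = f₁ + f₂ - 2 * (y₁ * y₂) := by linear_combination e₁ + e₂
        have E2 : (y₁ + y₂) ^ 2 = f₁ + f₂ + 2 * (y₁ * y₂) := by linear_combination e₁ + e₂
        have E3 : (y₁ * y₂) ^ 2 = f₁ * f₂ := by rw [mul_pow, e₁, e₂]
        rw [sub_neg_eq_add, E1, E2]
        generalize y₁ * y₂ = m at E3
        linear_combination -4 * E3
      · rw [hx₃, hx₄]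
        field_simp
        linear_combination 2 * e₁ + 2 * e₂
      · field_simp
        ring

end AddSub

/-! ### The approximate parallelogram law for the naive height -/

section Height

open Height

variable {K : Type*} [Field K] [DecidableEq K] [AdmissibleAbsValues K]
  {W : WeierstrassCurve K} [W.IsElliptic]

theorem exists_abs_logHeight_xRep_add_sub_le (h₁ : W.a₁ = 0) (h₃ : W.a₃ = 0) (h2 : (2 : K) ≠ 0) :
    ∃ C, ∀ P Q : W.toAffine.Point, |logHeight (P + Q).xRep + logHeight (P - Q).xRep -
      2 * (logHeight P.xRep + logHeight Q.xRep)| ≤ C := by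
  obtain ⟨C₁, hC₁⟩ := abs_logHeight_sym2_sub_le K
  obtain ⟨C₂, hC₂⟩ := abs_logHeight_addSubMap_sub_two_mul_logHeight_le W
  have key : ∀ P Q : W.toAffine.Point,
      |logHeight (P.sym2x Q) - (logHeight P.xRep + logHeight Q.xRep)| ≤ C₁ := by
    intro P Q
    have e : ∀ R : W.toAffine.Point, R.xRep = ![R.xRep 0, R.xRep 1] := fun R => by
      ext i; fin_cases i <;> rfl
    have hP := P.xRep_ne_zero
    have hQ := Q.xRep_ne_zero
    have := @hC₁ (P.xRep 0) (P.xRep 1) (Q.xRep 0) (Q.xRep 1) (by rwa [← e]) (by rwa [← e])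
    rwa [← e, ← e] at this
  refine ⟨3 * C₁ + C₂, fun P Q => ?_⟩
  obtain ⟨c, hc, h⟩ := exists_sym2x_add_sub h₁ h₃ h2 P Q
  have k1 := key (P + Q) (P - Q)
  rw [h, logHeight_smul_eq_logHeight _ hc] at k1
  have k2 := key P Q
  have k3 := hC₂ (P.sym2x Q)
  rw [abs_le] at *
  constructor <;> linarith [k1.1, k1.2, k2.1, k2.2, k3.1, k3.2]

end Height

/-! ### Northcott finiteness and descent -/

section NumberField

open Height

variable {K : Type*} [Field K] [NumberField K] {W : WeierstrassCurve K}

instance northcott_logHeight_xRep :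
    Northcott fun P : W.toAffine.Point => logHeight P.xRep where
  finite_le B := by
    have hfin : ({![1, 0]} ∪ (fun x : K => ![x, 1]) '' {x | logHeight₁ x ≤ B}).Finite :=
      (Set.finite_singleton _).union ((NumberField.finite_setOfPred_logHeight₁_le K B).image _)
    refine Set.Finite.of_finite_fibers Point.xRep (hfin.subset ?_) fun r _ => ?_
    · rintro _ ⟨P, hP, rfl⟩
      match P with
      | 0 => exact Or.inl rfl
      | .some x y h =>
        refine Or.inr ⟨x, ?_, rfl⟩
        rw [Set.mem_ofPred_eq, logHeight₁_eq_logHeight]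
        exact hP
    · rcases Set.eq_empty_or_nonempty
        ({P : W.toAffine.Point | logHeight P.xRep ≤ B} ∩ Point.xRep ⁻¹' {r}) with h | ⟨P, hP⟩
      · rw [h]; exact Set.finite_empty
      · refine (Set.toFinite {P, -P}).subset ?_
        rintro Q ⟨-, hQ⟩
        exact Point.eq_or_eq_neg_of_xRep_eq_xRep (hQ.trans hP.2.symm)

variable [DecidableEq K] [W.IsElliptic]

/-- The parallelogram law with `Q = P` gives `h(2P) ≥ 4 h(P) - c₀`, so torsion has bounded height.
-/
theorem finite_setOf_isOfFinAddOrder (h₁ : W.a₁ = 0) (h₃ : W.a₃ = 0) :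
    {P : W.toAffine.Point | IsOfFinAddOrder P}.Finite := by
  obtain ⟨C, hC⟩ := exists_abs_logHeight_xRep_add_sub_le h₁ h₃ two_ne_zero
  refine @Set.toFinite _ _ <| AddMonoid.finite_set_isOfFiniteOrder_of_descent (n := 2) (b := 4)
    (h := fun P : W.toAffine.Point => logHeight P.xRep)
    (c₀ := C + logHeight (0 : W.toAffine.Point).xRep) (by norm_num) fun P => ?_
  have := (abs_le.mp (hC P P)).1
  rw [sub_self] at this
  rw [two_nsmul]
  linarith

theorem addGroup_fg_of_finiteIndex (h₁ : W.a₁ = 0) (h₃ : W.a₃ = 0)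
    (h : (nsmulAddMonoidHom (α := W.toAffine.Point) 2).range.FiniteIndex) :
    AddGroup.FG W.toAffine.Point := by
  obtain ⟨C, hC⟩ := exists_abs_logHeight_xRep_add_sub_le h₁ h₃ two_ne_zero
  exact AddCommGroup.fg_of_descent' (h := fun P : W.toAffine.Point => logHeight P.xRep) h
    (fun P => logHeight_nonneg _) hC

end NumberField

/-! ### Positive rank and points of infinite order -/

section Rank

open scoped Classical in
theorem rankE_pos_iff {K : Type*} [Field K] :
    0 < rankE K ↔ ∃ P : (curveE K).toAffine.Point, ¬ IsOfFinAddOrder P := by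
  rw [rankE, pos_iff_ne_zero, Ne, rank_eq_zero_iff]
  push Not
  refine exists_congr fun P => ?_
  rw [isOfFinAddOrder_iff_zsmul_eq_zero]
  push Not
  rfl

end Rank

end FourSquares

namespace FourSquares

open WeierstrassCurve WeierstrassCurve.Affine

/-! ### Square classes under doubling and addition -/

section Points

variable {K : Type*} [Field K]

theorem finite_setOf_X_mem {W : WeierstrassCurve K} {S : Set K} (hS : S.Finite) :
    {P : W.toAffine.Point | ∀ x y h, P = .some x y h → x ∈ S}.Finite := by
  have hfin : ({![1, 0]} ∪ (fun x : K => ![x, 1]) '' S).Finite :=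
    (Set.finite_singleton _).union (hS.image _)
  refine (hfin.preimage' (f := Point.xRep (W' := W.toAffine)) fun r _ => ?_).subset ?_
  · rcases Set.eq_empty_or_nonempty (Point.xRep (W' := W.toAffine) ⁻¹' {r}) with h | ⟨P, hP⟩
    · rw [h]; exact Set.finite_empty
    · refine (Set.toFinite {P, -P}).subset fun Q hQ => ?_
      exact Point.eq_or_eq_neg_of_xRep_eq_xRep (hQ.trans (Eq.symm hP))
  · intro P hP
    match P with
    | 0 => exact Or.inl rfl
    | .some x y h => exact Or.inr ⟨x, hP x y h rfl, rfl⟩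

theorem curveE_nonsingular_iff [CharZero K] {x y : K} :
    (curveE K).toAffine.Nonsingular x y ↔ y ^ 2 = x * (x + 3) * (x - 1) := by
  rw [← curveE_equation_iff, equation_iff_nonsingular]

theorem curveE_double [CharZero K] [DecidableEq K] {x y : K}
    (h : (curveE K).toAffine.Nonsingular x y) (hy : y ≠ 0) :
    ∃ X Y h', Point.some x y h + Point.some x y h = Point.some X Y h' ∧
      X = ((x ^ 2 + 3) / (2 * y)) ^ 2 ∧ X + 3 = ((x ^ 2 + 6 * x - 3) / (2 * y)) ^ 2 ∧
      X - 1 = ((x ^ 2 - 2 * x - 3) / (2 * y)) ^ 2 := by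
  obtain ⟨X, Y, h', e, hX, -⟩ := add_self_of_Y_ne_zero (W := curveE K) rfl rfl two_ne_zero h hy
  have ee := curveE_nonsingular_iff.mp h
  change X = ((3 * x ^ 2 + 2 * 2 * x + -3) / (2 * y)) ^ 2 - 2 - 2 * x at hX
  refine ⟨X, Y, h', e, ?_, ?_, ?_⟩ <;> rw [hX] <;> field_simp
  · linear_combination (-8 - 8 * x) * ee
  · linear_combination (4 - 8 * x) * ee
  · linear_combination (-12 - 8 * x) * ee

/-- With the chord `y = l x + n`, the cubic `x (x + 3) (x - 1) - (l x + n) ^ 2` has the roots `x₁,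
x₂, x₃`; evaluate it at 0, -3 and 1. -/
theorem curveE_add [CharZero K] [DecidableEq K] {x₁ y₁ x₂ y₂ : K}
    (h₁ : (curveE K).toAffine.Nonsingular x₁ y₁) (h₂ : (curveE K).toAffine.Nonsingular x₂ y₂)
    (hx : x₁ ≠ x₂) :
    ∃ x₃ y₃ h₃ u v w, Point.some x₁ y₁ h₁ + Point.some x₂ y₂ h₂ = Point.some x₃ y₃ h₃ ∧
      x₁ * x₂ * x₃ = u ^ 2 ∧ (x₁ + 3) * (x₂ + 3) * (x₃ + 3) = v ^ 2 ∧
      (x₁ - 1) * (x₂ - 1) * (x₃ - 1) = w ^ 2 := by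
  obtain ⟨x₃, y₃, h₃, e, hx₃, -⟩ := add_some_of_X_ne (W := curveE K) rfl rfl h₁ h₂ hx
  have e₁ := curveE_nonsingular_iff.mp h₁
  have e₂ := curveE_nonsingular_iff.mp h₂
  change x₃ = ((y₁ - y₂) / (x₁ - x₂)) ^ 2 - 2 - x₁ - x₂ at hx₃
  have hs := sub_ne_zero.mpr hx
  set l := (y₁ - y₂) / (x₁ - x₂) with hl
  have hl' : l * (x₁ - x₂) = y₁ - y₂ := by rw [hl]; field_simp
  set n := y₁ - l * x₁ with hn
  have E₁ : (l * x₁ + n) ^ 2 = x₁ * (x₁ + 3) * (x₁ - 1) := by rw [← e₁, hn]; ring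
  have E₂ : (l * x₂ + n) ^ 2 = x₂ * (x₂ + 3) * (x₂ - 1) := by
    rw [← e₂, hn]; linear_combination (-(l * (x₂ - x₁)) - y₂ - y₁) * hl'
  have a₄ : x₁ * x₂ + (x₁ + x₂) * x₃ = -3 - 2 * l * n := by
    refine mul_left_cancel₀ hs ?_
    rw [hx₃]
    linear_combination E₁ - E₂
  have a₆ : x₁ * x₂ * x₃ = n ^ 2 := by
    rw [hx₃] at a₄ ⊢
    linear_combination x₁ * a₄ - E₁
  exact ⟨x₃, y₃, h₃, n, n - 3 * l, l + n, e, a₆,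
    by linear_combination a₆ + 3 * a₄ + 9 * hx₃, by linear_combination a₆ - a₄ + hx₃⟩

end Points

/-! ### Progressions and points -/

section Progressions

variable {K : Type*} [Field K]

theorem exists_eq_smul_of_isProgression {q : Fin 4 → K} (h : IsProgression q) :
    ∃ t δ : K, δ ≠ 0 ∧ q = δ • ![t, t + 1, t + 2, t + 3] := by
  have hδ : q 1 - q 0 ≠ 0 := sub_ne_zero.mpr h.nonconst
  have h1 := h.diff_one
  have h2 := h.diff_two
  refine ⟨q 0 / (q 1 - q 0), q 1 - q 0, hδ, ?_⟩
  ext i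
  fin_cases i
  · simp [mul_div_cancel₀ _ hδ]
  · simp [mul_add, mul_div_cancel₀ _ hδ]
  · simp [mul_add, mul_div_cancel₀ _ hδ]
    linear_combination -h1
  · simp [mul_add, mul_div_cancel₀ _ hδ]
    linear_combination -h2 - 2 * h1

theorem vec_add_ne_zero (t : K) : ![t, t + 1, t + 2, t + 3] ≠ 0 := by
  intro h
  have h0 : t = 0 := congrFun h 0
  have h1 : t + 1 = 0 := congrFun h 1
  rw [h0, zero_add] at h1
  exact one_ne_zero h1

variable [CharZero K]

theorem infinite_points_of_infinite_progressions (h : (progressions K).Infinite) :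
    Infinite (curveE K).toAffine.Point := by
  let T : Set K := {t | ∃ δ : K, δ ≠ 0 ∧ ∀ i, IsSquare ((δ • ![t, t + 1, t + 2, t + 3]) i)}
  have hT : T.Infinite := by
    intro hfin
    refine h ((hfin.image fun t => Projectivization.mk K _ (vec_add_ne_zero t)).subset ?_)
    rintro P ⟨q, hq, hprog, rfl⟩
    obtain ⟨t, δ, hδ, rfl⟩ := exists_eq_smul_of_isProgression hprog
    refine ⟨t, ⟨δ, hδ, hprog.isSquare⟩, ?_⟩
    rw [Projectivization.mk_eq_mk_iff']
    exact ⟨δ⁻¹, by rw [smul_smul, inv_mul_cancel₀ hδ, one_smul]⟩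
  -- The parameter `t = 0` corresponds to the point at infinity.
  have hT0 : (T \ {0}).Infinite := hT.sdiff (Set.finite_singleton 0)
  by_contra hfin
  rw [not_infinite_iff_finite] at hfin
  have key : ∀ t : ↥(T \ {0}), ∃ y, (curveE K).toAffine.Nonsingular (6 / (t : K) + 3) y := by
    rintro ⟨t, ⟨δ, hδ, hsq⟩, ht⟩
    have ht : t ≠ 0 := ht
    obtain ⟨a, ha⟩ := hsq 0
    obtain ⟨b, hb⟩ := hsq 1
    obtain ⟨c, hc⟩ := hsq 2
    obtain ⟨d, hd⟩ := hsq 3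
    simp only [Pi.smul_apply, smul_eq_mul, Matrix.cons_val] at ha hb hc hd
    -- For `x = 6 / t + 3` the factors `x`, `x + 3`, `x - 1` are `3(t + 2) / t`, `6(t + 1) / t`,
    -- `2(t + 3) / t`.
    refine ⟨6 * a * b * c * d / (δ ^ 2 * t ^ 2), curveE_nonsingular_iff.mpr ?_⟩
    have : (6 * a * b * c * d) ^ 2 = 36 * (δ * t) * (δ * (t + 1)) * (δ * (t + 2)) * (δ * (t + 3)) := by
      rw [ha, hb, hc, hd]; ring
    rw [div_pow, this]
    field_simp
    ring
  choose y hy using key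
  have hinj : Function.Injective fun t : ↥(T \ {0}) => Point.some _ _ (hy t) := by
    intro s t hst
    have hst := Point.some.inj hst
    have hs : (s : K) ≠ 0 := s.2.2
    have ht : (t : K) ≠ 0 := t.2.2
    have := hst.1
    field_simp at this
    apply Subtype.ext
    have h6 : (6 : K) ≠ 0 := by norm_num
    apply mul_left_cancel₀ h6
    linear_combination -this
  have := hT0.to_subtype
  exact not_injective_infinite_finite _ hinj

/-- The progression attached to a point with `X`-coordinate `x`. -/
def progressionOfX (x : K) : Fin 4 → K := ![36, 6 * (x + 3), 12 * x, 18 * (x - 1)]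

theorem progressionOfX_ne_zero (x : K) : progressionOfX x ≠ 0 := fun h => by
  have : (36 : K) = 0 := congrFun h 0
  norm_num at this

theorem isProgression_progressionOfX {x : K} (hx : x ≠ 3) (h₁ : IsSquare (6 * (x + 3)))
    (h₂ : IsSquare (12 * x)) (h₃ : IsSquare (18 * (x - 1))) : IsProgression (progressionOfX x) where
  isSquare i := by
    fin_cases i
    exacts [⟨6, by norm_num [progressionOfX]⟩, h₁, h₂, h₃]
  diff_one := by simp [progressionOfX]; ring
  diff_two := by simp [progressionOfX]; ring
  nonconst := by
    intro h
    have h : 6 * (x + 3) = 36 := h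
    exact hx (by linear_combination h / 6)

/-- Translating a double by `T = (3, 6)` moves `x`, `x + 3`, `x - 1` into the square classes of 3, 6
and 2, exactly those required by `progressionOfX`. -/
theorem infinite_progressions_of_not_isOfFinAddOrder [DecidableEq K]
    {Q : (curveE K).toAffine.Point} (hQ : ¬ IsOfFinAddOrder Q) : (progressions K).Infinite := by
  let G : Set K := {x | x ≠ 3 ∧ IsSquare (6 * (x + 3)) ∧ IsSquare (12 * x) ∧ IsSquare (18 * (x - 1))}
  suffices hG : G.Infinite by
    have hinj : Function.Injective fun x : K => Projectivization.mk K _ (progressionOfX_ne_zero x) := by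
      intro x y hxy
      rw [Projectivization.mk_eq_mk_iff'] at hxy
      obtain ⟨a, ha⟩ := hxy
      have h0 : a * 36 = 36 := congrFun ha 0
      have h2 : a * (12 * y) = 12 * x := congrFun ha 2
      have ha : a = 1 := by linear_combination h0 / 36
      rw [ha] at h2
      linear_combination -h2 / 12
    refine (hG.image hinj.injOn).mono ?_
    rintro _ ⟨x, ⟨hx, h₁, h₂, h₃⟩, rfl⟩
    exact ⟨_, _, isProgression_progressionOfX hx h₁ h₂ h₃, rfl⟩
  intro hfin
  have hT : (curveE K).toAffine.Nonsingular 3 6 := curveE_nonsingular_iff.mpr (by norm_num)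
  set T := Point.some 3 6 hT
  have fin₁ := finite_setOf_X_mem (W := curveE K) (hfin.union (Set.finite_singleton 3))
  -- Avoiding 0, 1, -3 keeps the squares attached to the double nonzero; avoiding 3 makes the chord
  -- through T available.
  have fin₂ := finite_setOf_X_mem (W := curveE K) (Set.toFinite ({0, 1, -3, 3} : Set K))
  have hinj : Function.Injective fun j : ℕ => j • Q + j • Q := by
    intro i j hij
    simp only [← add_nsmul] at hij
    have := (injective_nsmul_iff_not_isOfFinAddOrder.mpr hQ) hij
    omega
  refine Set.infinite_univ (α := ℕ) (((fin₂.preimage hinj.injOn).union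
    (fin₁.preimage ((add_right_injective T).comp hinj).injOn)).subset fun j _ => ?_)
  by_contra hj
  rw [Set.mem_union, not_or] at hj
  obtain ⟨hj₂, hj₁⟩ := hj
  simp only [Set.mem_preimage, Set.mem_ofPred_eq, not_forall, Function.comp] at hj₁ hj₂
  obtain ⟨X, Y, h, e, hX⟩ := hj₂
  obtain ⟨x, y, h', e', hx⟩ := hj₁
  simp only [Set.mem_insert_iff, Set.mem_singleton_iff, not_or] at hX
  rw [Set.mem_union, Set.mem_singleton_iff, not_or] at hx
  refine hx.1 ⟨hx.2, ?_⟩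
  generalize hR : j • Q = R at *
  match R with
  | 0 => rw [add_zero] at e; exact absurd e.symm (Point.some_ne_zero _)
  | .some r s hr =>
    by_cases hs : s = 0
    · rw [add_self_of_Y_eq_zero rfl rfl hr hs] at e
      exact absurd e.symm (Point.some_ne_zero _)
    obtain ⟨X', Y', h'', e'', hX0, hX3, hX1⟩ := curveE_double hr hs
    rw [e'', Point.some.injEq] at e
    obtain ⟨rfl, rfl⟩ := e
    obtain ⟨x₃, y₃, h₃, u, v, w, e₃, hu, hv, hw⟩ := curveE_add hT h'' (Ne.symm hX.2.2.2)
    rw [e'', e₃, Point.some.injEq] at e'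
    obtain ⟨rfl, rfl⟩ := e'
    have n0 : X' ≠ 0 := hX.1
    have n1 : X' - 1 ≠ 0 := sub_ne_zero.mpr hX.2.1
    have n3 : X' + 3 ≠ 0 := fun h => hX.2.2.1 (by linear_combination h)
    refine ⟨⟨v / ((r ^ 2 + 6 * r - 3) / (2 * s)), ?_⟩, ⟨2 * u / ((r ^ 2 + 3) / (2 * s)), ?_⟩,
      ⟨3 * w / ((r ^ 2 - 2 * r - 3) / (2 * s)), ?_⟩⟩
    · rw [← sq, div_pow, ← hX3, ← hv]; field_simp; ring
    · rw [← sq, div_pow, ← hX0, mul_pow, ← hu]; field_simp; ring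
    · rw [← sq, div_pow, ← hX1, mul_pow, ← hw]; field_simp; ring

end Progressions

open scoped Classical in
theorem infinite_progressions_iff {K : Type*} [Field K] [NumberField K] :
    (progressions K).Infinite ↔ 0 < rankE K := by
  rw [rankE_pos_iff]
  refine ⟨fun h => ?_, fun ⟨Q, hQ⟩ => infinite_progressions_of_not_isOfFinAddOrder hQ⟩
  have := infinite_points_of_infinite_progressions h
  by_contra! hall
  refine Set.infinite_univ (α := (curveE K).toAffine.Point)
    ((finite_setOf_isOfFinAddOrder (W := curveE K) rfl rfl).subset fun P _ => hall P)

end FourSquares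

namespace FourSquares

open WeierstrassCurve WeierstrassCurve.Affine

/-! ### Halving points -/

section Halving

variable {K : Type*} [Field K] [CharZero K] [DecidableEq K]

/-- If `x`, `x + 3`, `x - 1` are the squares of α, β, γ, a half has first coordinate `(α + β) (α +
γ)`; that `x` is a square follows from the equation. -/
theorem exists_half {x y : K} (h : (curveE K).toAffine.Nonsingular x y) (hy : y ≠ 0)
    (h₃ : IsSquare (x + 3)) (h₁ : IsSquare (x - 1)) :
    ∃ Q : (curveE K).toAffine.Point, Point.some x y h = Q + Q := by
  have e := curveE_nonsingular_iff.mp h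
  obtain ⟨β, hβ⟩ := h₃
  obtain ⟨γ, hγ⟩ := h₁
  have hβ0 : β ≠ 0 := by
    rintro rfl
    apply hy
    rw [hβ] at e
    simpa using e
  have hγ0 : γ ≠ 0 := by
    rintro rfl
    apply hy
    rw [hγ] at e
    simpa using e
  obtain ⟨α, hα⟩ : ∃ α, x = α * α :=
    ⟨y / (β * γ), by field_simp; rw [e, sq, sq, ← hβ, ← hγ]⟩
  have h12 : (α + β) * (α - β) = -3 := by linear_combination hβ - hα
  have h13 : (α + γ) * (α - γ) = 1 := by linear_combination hγ - hα
  have h23 : (β + γ) * (β - γ) = 4 := by linear_combination hγ - hβ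
  have n12 : α + β ≠ 0 := fun h => by rw [h, zero_mul] at h12; norm_num at h12
  have n13 : α + γ ≠ 0 := fun h => by rw [h, zero_mul] at h13; norm_num at h13
  have n23 : β + γ ≠ 0 := fun h => by rw [h, zero_mul] at h23; norm_num at h23
  have eQ : ((α + β) * (β + γ) * (α + γ)) ^ 2 = ((α + β) * (α + γ)) * ((α + β) * (α + γ) + 3) *
      ((α + β) * (α + γ) - 1) := by
    have e1 : (α + β) * (α + γ) + 3 = (α + β) * (β + γ) := by linear_combination h12
    have e2 : (α + β) * (α + γ) - 1 = (α + γ) * (β + γ) := by linear_combination h13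
    rw [e1, e2]; ring
  have hQ := curveE_nonsingular_iff.mpr eQ
  obtain ⟨X, Y, h', e', hX, -, -⟩ :=
    curveE_double hQ (mul_ne_zero (mul_ne_zero n12 n23) n13)
  have hx : x = X := by
    rw [hX, hα, ← sq]
    congr 1
    field_simp
    linear_combination 3 * h13 - (α - γ) * (α + γ) * h12
  rcases Point.X_eq_iff (h₁ := h) (h₂ := h').mp hx with h | h
  · exact ⟨_, h.trans e'.symm⟩
  · exact ⟨-Point.some _ _ hQ, by rw [h, ← e', neg_add]⟩

end Halving

/-! ### Arithmetic of the 2-descent over ℚ -/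

section Arithmetic

theorem exists_squarefree_dvd_of_mul_eq_sq {a c t : ℤ} (h : a * c = t ^ 2) (ha : a ≠ 0) :
    ∃ d k : ℤ, a = d * k ^ 2 ∧ Squarefree d ∧ d ∣ c := by
  obtain ⟨d₀, k₀, hdk, hd₀⟩ := Nat.sq_mul_squarefree a.natAbs
  have hk₀ : (k₀ : ℤ) ≠ 0 := by
    rintro hk
    have : k₀ = 0 := by exact_mod_cast hk
    rw [this] at hdk
    apply ha
    rw [← Int.natAbs_eq_zero, ← hdk]
    simp
  have hd : Squarefree (a.sign * (d₀ : ℤ)) := by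
    rw [← Int.squarefree_natAbs, Int.natAbs_mul, Int.natAbs_sign_of_ne_zero ha]
    simpa using hd₀
  have hak : a = a.sign * d₀ * (k₀ : ℤ) ^ 2 := by
    conv_lhs => rw [← Int.sign_mul_natAbs a, ← hdk]
    push_cast
    ring
  generalize a.sign * (d₀ : ℤ) = d at *
  generalize (k₀ : ℤ) = k at *
  refine ⟨d, k, hak, hd, ?_⟩
  have hkt : k ∣ t := (Int.pow_dvd_pow_iff two_ne_zero).mp ⟨d * c, by rw [← h, hak]; ring⟩
  obtain ⟨t', rfl⟩ := hkt
  have h' : d * c = t' ^ 2 := by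
    apply mul_left_cancel₀ (pow_ne_zero 2 hk₀)
    linear_combination h - c * hak
  have hdt : d ∣ t' := (hd.dvd_pow_iff_dvd two_ne_zero).mp ⟨c, h'.symm⟩
  obtain ⟨r, rfl⟩ := hdt
  exact ⟨r ^ 2, mul_left_cancel₀ hd.ne_zero (by linear_combination h')⟩

theorem three_dvd_of_sq_add_sq {u v : ℤ} (h : (3 : ℤ) ∣ u ^ 2 + v ^ 2) : 3 ∣ u ∧ 3 ∣ v := by
  have hu : u % 3 = 0 ∨ u % 3 = 1 ∨ u % 3 = 2 := by omega
  have hv : v % 3 = 0 ∨ v % 3 = 1 ∨ v % 3 = 2 := by omega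
  rw [Int.dvd_iff_emod_eq_zero, Int.add_emod, sq, sq, Int.mul_emod, Int.mul_emod v] at h
  rcases hu with hu | hu | hu <;> rcases hv with hv | hv | hv <;> rw [hu, hv] at h <;>
    norm_num at h
  exact ⟨by omega, by omega⟩

/-- Write `a = d₁ u²` and `a - b = d₃ v²` with squarefree `d₁`, `d₃`. Coprimality forces `d₁ ∣ 3`
and `d₃ ∣ 2`, leaving sixteen sign and divisor patterns: eight fail by sign, four by descent modulo
3, and four survive. -/
theorem square_classes {a b t : ℤ} (hb : 0 < b) (hab : IsCoprime a b)
    (h : b * (a * (a + 3 * b) * (a - b)) = t ^ 2) (ht : t ≠ 0) : IsSquare b ∧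
      ((IsSquare (a + 3 * b) ∧ IsSquare (a - b)) ∨
       (IsSquare (6 * (a + 3 * b)) ∧ IsSquare (2 * (a - b))) ∨
       (IsSquare (3 * (a + 3 * b)) ∧ IsSquare (-(a - b))) ∨
       (IsSquare (2 * (a + 3 * b)) ∧ IsSquare (-2 * (a - b)))) := by
  have hprod : b * (a * (a + 3 * b) * (a - b)) ≠ 0 := h ▸ pow_ne_zero 2 ht
  have ha0 : a ≠ 0 := by rintro rfl; simp at hprod
  have hab0 : a - b ≠ 0 := by intro h0; simp [h0] at hprod
  have cop1 : IsCoprime b (a + 3 * b) := (IsCoprime.add_mul_right_right hab.symm 3)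
  have cop2 : IsCoprime b (a - b) := by
    have := IsCoprime.add_mul_left_right hab.symm (-1)
    rwa [mul_neg_one, ← sub_eq_add_neg] at this
  obtain ⟨s, hs⟩ : ∃ s, b = s ^ 2 := by
    obtain ⟨s, hs | hs⟩ := Int.sq_of_isCoprime ((hab.symm.mul_right cop1).mul_right cop2) h
    · exact ⟨s, hs⟩
    · exact absurd hb (by rw [hs]; nlinarith [sq_nonneg s])
  obtain ⟨t₁, rfl⟩ : s ∣ t := (Int.pow_dvd_pow_iff two_ne_zero).mp ⟨_, by rw [← h, hs]⟩
  have hs0 : s ≠ 0 := by rintro rfl; simp at ht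
  have h₁ : a * (a + 3 * b) * (a - b) = t₁ ^ 2 := by
    apply mul_left_cancel₀ (pow_ne_zero 2 hs0)
    linear_combination h - (a * (a + 3 * b) * (a - b)) * hs
  obtain ⟨d₁, u, hu, sf₁, hd₁⟩ := exists_squarefree_dvd_of_mul_eq_sq
    (by rw [← h₁, mul_assoc] : a * ((a + 3 * b) * (a - b)) = t₁ ^ 2) ha0
  obtain ⟨d₃, v, hv, sf₃, hd₃⟩ := exists_squarefree_dvd_of_mul_eq_sq
    (by rw [← h₁]; ring : (a - b) * (a * (a + 3 * b)) = t₁ ^ 2) hab0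
  have hu0 : u ≠ 0 := by rintro rfl; simp [hu] at ha0
  have hv0 : v ≠ 0 := by rintro rfl; simp [hv] at hab0
  have hd₁3 : d₁ ∣ 3 := by
    have hda : d₁ ∣ a := ⟨_, hu⟩
    have hcop : IsCoprime d₁ b := hab.of_isCoprime_of_dvd_left hda
    have : d₁ ∣ b * (b * 3) := by
      have h2 : b * (b * 3) = a * (a + 2 * b) - (a + 3 * b) * (a - b) := by ring
      rw [h2]
      exact (hda.mul_right _).sub hd₁
    exact hcop.dvd_of_dvd_mul_left (hcop.dvd_of_dvd_mul_left this)
  have hd₃2 : d₃ ∣ 2 := by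
    have hda : d₃ ∣ a - b := ⟨_, hv⟩
    have hcop : IsCoprime d₃ b := cop2.symm.of_isCoprime_of_dvd_left hda
    have : d₃ ∣ b * (b * 2 ^ 2) := by
      have h2 : b * (b * 2 ^ 2) = a * (a + 3 * b) - (a - b) * (a + 4 * b) := by ring
      rw [h2]
      exact hd₃.sub (hda.mul_right _)
    exact (sf₃.dvd_pow_iff_dvd two_ne_zero).mp
      (hcop.dvd_of_dvd_mul_left (hcop.dvd_of_dvd_mul_left this))
  obtain ⟨w, hw⟩ : ∃ w, d₁ * d₃ * (a + 3 * b) = w ^ 2 := by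
    have e : (u * v) ^ 2 * (d₁ * d₃ * (a + 3 * b)) = t₁ ^ 2 := by
      rw [← h₁]
      linear_combination -((a + 3 * b) * (a - b)) * hu - (a + 3 * b) * d₁ * u ^ 2 * hv
    obtain ⟨w, rfl⟩ : u * v ∣ t₁ := (Int.pow_dvd_pow_iff two_ne_zero).mp ⟨_, e.symm⟩
    exact ⟨w, mul_left_cancel₀ (pow_ne_zero 2 (mul_ne_zero hu0 hv0)) (by linear_combination e)⟩
  refine ⟨⟨s, by rw [hs, sq]⟩, ?_⟩
  have c₁ : d₁ = 1 ∨ d₁ = 3 ∨ d₁ = -1 ∨ d₁ = -3 := by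
    have := Int.le_of_dvd (by norm_num) hd₁3
    have := Int.le_of_dvd (by norm_num) ((neg_dvd (a := d₁)).mpr hd₁3)
    have : -3 ≤ d₁ := by omega
    interval_cases d₁ <;> simp_all
  have c₃ : d₃ = 1 ∨ d₃ = 2 ∨ d₃ = -1 ∨ d₃ = -2 := by
    have := Int.le_of_dvd (by norm_num) hd₃2
    have := Int.le_of_dvd (by norm_num) ((neg_dvd (a := d₃)).mpr hd₃2)
    have : -2 ≤ d₃ := by omega
    interval_cases d₃ <;> simp_all
  have not3 : (3 : ℤ) ∣ a → (3 : ℤ) ∣ b → False := fun h h' => by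
    have := hab.isUnit_of_dvd' h h'
    norm_num [Int.isUnit_iff] at this
  have u2 : 0 < u ^ 2 := by positivity
  have v2 : 0 < v ^ 2 := by positivity
  have w2 := sq_nonneg w
  rcases c₁ with rfl | rfl | rfl | rfl <;> rcases c₃ with rfl | rfl | rfl | rfl
  · exact Or.inl ⟨⟨w, by linarith⟩, ⟨v, by linarith⟩⟩
  · exfalso
    obtain ⟨⟨u', rfl⟩, ⟨w', rfl⟩⟩ := three_dvd_of_sq_add_sq (u := u) (v := w)
      ⟨a + 2 * b, by linarith⟩
    have h3 : 2 * b = 3 * (w' ^ 2 - 2 * u' ^ 2) := by linarith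
    exact not3 ⟨3 * u' ^ 2, by linarith⟩ (by omega)
  · exfalso; linarith
  · exfalso; linarith
  · exfalso
    obtain ⟨⟨s', rfl⟩, -⟩ := three_dvd_of_sq_add_sq (u := s) (v := v) ⟨u ^ 2, by linarith⟩
    exact not3 ⟨u ^ 2, by linarith⟩ ⟨3 * s' ^ 2, by linarith⟩
  · exact Or.inr (Or.inl ⟨⟨w, by linarith⟩, ⟨2 * v, by linarith⟩⟩)
  · exfalso; linarith
  · exfalso; linarith
  · exfalso; linarith
  · exfalso; linarith
  · exfalso
    obtain ⟨⟨u', rfl⟩, ⟨w', rfl⟩⟩ := three_dvd_of_sq_add_sq (u := u) (v := w)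
      ⟨b, by linarith⟩
    exact not3 ⟨-(3 * u' ^ 2), by linarith⟩ ⟨u' ^ 2 + w' ^ 2, by linarith⟩
  · exact Or.inr (Or.inr (Or.inr ⟨⟨w, by linarith⟩, ⟨2 * v, by linarith⟩⟩))
  · exfalso; linarith
  · exfalso; linarith
  · exact Or.inr (Or.inr (Or.inl ⟨⟨w, by linarith⟩, ⟨v, by linarith⟩⟩))
  · exfalso
    obtain ⟨⟨s', rfl⟩, -⟩ := three_dvd_of_sq_add_sq (u := s) (v := v)
      ⟨v ^ 2 - u ^ 2, by linarith⟩
    exact not3 ⟨-u ^ 2, by linarith⟩ ⟨3 * s' ^ 2, by linarith⟩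

/-- The four classes are those of the torsion points 0, `(3, 6)`, `(0, 0)` and `(-1, 2)`, in this
order. -/
theorem square_classes_rat {x y : ℚ} (h : y ^ 2 = x * (x + 3) * (x - 1)) (hy : y ≠ 0) :
    (IsSquare (x + 3) ∧ IsSquare (x - 1)) ∨
      (IsSquare (6 * (x + 3)) ∧ IsSquare (2 * (x - 1))) ∨
      (IsSquare (3 * (x + 3)) ∧ IsSquare (-(x - 1))) ∨
      (IsSquare (2 * (x + 3)) ∧ IsSquare (-2 * (x - 1))) := by
  have hd : (x.den : ℚ) ≠ 0 := by exact_mod_cast x.den_ne_zero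
  have hx : (x.num : ℚ) = x * x.den := (Rat.mul_den_eq_num x).symm
  obtain ⟨t, ht⟩ : IsSquare ((x.den : ℤ) * (x.num * (x.num + 3 * x.den) * (x.num - x.den))) := by
    rw [← Rat.isSquare_intCast_iff]
    refine ⟨y * x.den ^ 2, ?_⟩
    push_cast
    rw [hx]
    linear_combination -(x.den : ℚ) ^ 4 * h
  have ht0 : t ≠ 0 := by
    rintro rfl
    have h0 : ((x.den : ℚ) * (x.num * (x.num + 3 * x.den) * (x.num - x.den))) = 0 := by
      exact_mod_cast ht
    rw [hx] at h0
    have : (x.den : ℚ) ^ 4 * y ^ 2 = 0 := by rw [h]; linear_combination h0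
    exact mul_ne_zero (pow_ne_zero 4 hd) (pow_ne_zero 2 hy) this
  obtain ⟨⟨s, hs⟩, hcl⟩ := square_classes (a := x.num) (b := x.den)
    (by exact_mod_cast x.den_pos) (Rat.isCoprime_num_den x) (by rw [ht, sq]) ht0
  have hs' : (x.den : ℚ) = s * s := by exact_mod_cast hs
  have hs0 : (s : ℚ) ≠ 0 := by rintro h0; rw [h0] at hs'; simp at hs'
  have descend : ∀ (n : ℤ) (z : ℚ), (n : ℚ) = z * x.den → IsSquare n → IsSquare z := by
    rintro n z hz ⟨r, rfl⟩
    refine ⟨r / s, ?_⟩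
    rw [hs'] at hz
    push_cast at hz
    field_simp
    linear_combination -hz
  refine hcl.imp (.imp ?_ ?_) (.imp (.imp ?_ ?_) (.imp (.imp ?_ ?_) (.imp ?_ ?_))) <;>
    refine descend _ _ ?_ <;> push_cast <;> rw [hx] <;> ring

end Arithmetic

/-! ### All rational points of E are torsion -/

section RationalPoints

variable {K : Type*} [Field K] [DecidableEq K]

theorem isOfFinAddOrder_of_Y_eq_zero {x y : K} (h : (curveE K).toAffine.Nonsingular x y)
    (hy : y = 0) : IsOfFinAddOrder (Point.some x y h) :=
  isOfFinAddOrder_iff_nsmul_eq_zero.mpr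
    ⟨2, two_pos, by rw [two_nsmul, add_self_of_Y_eq_zero rfl rfl h hy]⟩

variable [CharZero K]

/-- The hypothesis says that the double has first coordinate 1, so it is the 2-torsion point `(1,
0)`. -/
theorem isOfFinAddOrder_of_sq_eq {x y : K} (h : (curveE K).toAffine.Nonsingular x y) (hy : y ≠ 0)
    (hx : (x ^ 2 + 3) ^ 2 = (2 * y) ^ 2) : IsOfFinAddOrder (Point.some x y h) := by
  obtain ⟨X, Y, h', e, hX, -, -⟩ := curveE_double h hy
  rw [div_pow, hx, div_self (pow_ne_zero 2 (mul_ne_zero two_ne_zero hy))] at hX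
  have hY : Y = 0 := by
    have := curveE_nonsingular_iff.mp h'
    rw [hX] at this
    simpa using this
  refine isOfFinAddOrder_iff_nsmul_eq_zero.mpr ⟨4, by norm_num, ?_⟩
  rw [show 4 = 2 * 2 by norm_num, mul_nsmul, two_nsmul, two_nsmul, e,
    add_self_of_Y_eq_zero rfl rfl h' hY]

/-- The sum of the two points has square `x + 3` and `x - 1`, so it can be halved. In the degenerate
cases the second point is itself torsion. -/
theorem exists_torsion_add_double {x₁ y₁ x y : K} (h₁ : (curveE K).toAffine.Nonsingular x₁ y₁)
    (hfin : IsOfFinAddOrder (Point.some x₁ y₁ h₁)) (n₃ : x₁ + 3 ≠ 0) (n₁ : x₁ - 1 ≠ 0)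
    (h : (curveE K).toAffine.Nonsingular x y)
    (hs₃ : IsSquare ((x₁ + 3) * (x + 3))) (hs₁ : IsSquare ((x₁ - 1) * (x - 1))) :
    ∃ T Q : (curveE K).toAffine.Point, IsOfFinAddOrder T ∧ Point.some x y h = T + (Q + Q) := by
  by_cases hx : x₁ = x
  · refine ⟨Point.some x y h, 0, ?_, by simp⟩
    rcases Point.X_eq_iff (h₁ := h) (h₂ := h₁).mp hx.symm with e | e <;> rw [e]
    exacts [hfin, hfin.neg]
  obtain ⟨x₃, y₃, h₃, -, v, w, e, -, hv, hw⟩ := curveE_add h₁ h hx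
  have eq : Point.some x y h = -Point.some x₁ y₁ h₁ + Point.some x₃ y₃ h₃ := by
    rw [← e, neg_add_cancel_left]
  by_cases hy₃ : y₃ = 0
  · refine ⟨Point.some x y h, 0, ?_, by simp⟩
    rw [eq]
    exact (AddCommute.all _ _).isOfFinAddOrder_add hfin.neg (isOfFinAddOrder_of_Y_eq_zero h₃ hy₃)
  have div : ∀ {p q r : K}, IsSquare p → p * q = r ^ 2 → q = 0 ∨ p ≠ 0 → IsSquare q := by
    rintro p q r ⟨s, rfl⟩ hr (rfl | hp)
    · exact IsSquare.zero
    · have hs : s ≠ 0 := left_ne_zero_of_mul hp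
      exact ⟨r / s, by field_simp; linear_combination hr⟩
  by_cases hy : y = 0
  · exact ⟨Point.some x y h, 0, isOfFinAddOrder_of_Y_eq_zero h hy, by simp⟩
  have ey := curveE_nonsingular_iff.mp h
  have m₃ : x + 3 ≠ 0 := fun h0 => hy (by simpa [h0] using ey)
  have m₁ : x - 1 ≠ 0 := fun h0 => hy (by simpa [h0] using ey)
  obtain ⟨Q, hQ⟩ := exists_half h₃ hy₃ (div hs₃ hv (Or.inr (mul_ne_zero n₃ m₃)))
    (div hs₁ hw (Or.inr (mul_ne_zero n₁ m₁)))
  exact ⟨_, Q, hfin.neg, by rw [eq, hQ]⟩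

theorem exists_torsion_add_double_rat (P : (curveE ℚ).toAffine.Point) :
    ∃ T Q : (curveE ℚ).toAffine.Point, IsOfFinAddOrder T ∧ P = T + (Q + Q) := by
  match P with
  | 0 => exact ⟨0, 0, IsOfFinAddOrder.zero, by simp⟩
  | .some x y h =>
    by_cases hy : y = 0
    · exact ⟨Point.some x y h, 0, isOfFinAddOrder_of_Y_eq_zero h hy, by simp⟩
    rcases square_classes_rat (curveE_nonsingular_iff.mp h) hy with
      ⟨h₃, h₁⟩ | ⟨h₃, h₁⟩ | ⟨h₃, h₁⟩ | ⟨h₃, h₁⟩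
    · obtain ⟨Q, hQ⟩ := exists_half h hy h₃ h₁
      exact ⟨0, Q, IsOfFinAddOrder.zero, by rw [hQ, zero_add]⟩
    · have hT : (curveE ℚ).toAffine.Nonsingular 3 6 := curveE_nonsingular_iff.mpr (by norm_num)
      refine exists_torsion_add_double hT (isOfFinAddOrder_of_sq_eq hT ?_ ?_) ?_ ?_ h ?_ ?_ <;>
        norm_num <;> assumption
    · have hT : (curveE ℚ).toAffine.Nonsingular 0 0 := curveE_nonsingular_iff.mpr (by norm_num)
      refine exists_torsion_add_double hT (isOfFinAddOrder_of_Y_eq_zero hT rfl) (by norm_num)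
        (by norm_num) h (by rwa [show (0 + 3) * (x + 3) = 3 * (x + 3) by ring])
        (by rwa [show (0 - 1) * (x - 1) = -(x - 1) by ring])
    · have hT : (curveE ℚ).toAffine.Nonsingular (-1) 2 := curveE_nonsingular_iff.mpr (by norm_num)
      refine exists_torsion_add_double hT (isOfFinAddOrder_of_sq_eq hT (by norm_num) (by norm_num))
        (by norm_num) (by norm_num) h (by rwa [show (-1 + 3) * (x + 3) = 2 * (x + 3) by ring])
        (by rwa [show (-1 - 1) * (x - 1) = -2 * (x - 1) by ring])

/-- An abelian group that is finitely generated and satisfies `G = G_tors + 2 G` is torsion. -/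
theorem isOfFinAddOrder_of_fg {G : Type*} [AddCommGroup G] [AddGroup.FG G]
    (h : ∀ P : G, ∃ T Q : G, IsOfFinAddOrder T ∧ P = T + (Q + Q)) (P : G) :
    IsOfFinAddOrder P := by
  let N := G ⧸ Submodule.torsion ℤ G
  have hfg : Module.Finite ℤ G := Module.Finite.iff_addGroup_fg.mpr inferInstance
  have hle : (⊤ : Submodule ℤ N) ≤ Ideal.span {(2 : ℤ)} • ⊤ := by
    rintro n -
    obtain ⟨P, rfl⟩ := Submodule.mkQ_surjective _ n
    obtain ⟨T, Q, hT, rfl⟩ := h P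
    obtain ⟨k, hk, hkT⟩ := isOfFinAddOrder_iff_nsmul_eq_zero.mp hT
    have h0 : (Submodule.torsion ℤ G).mkQ T = 0 := by
      rw [Submodule.mkQ_apply, Submodule.Quotient.mk_eq_zero, Submodule.mem_torsion_iff]
      exact ⟨⟨(k : ℤ), mem_nonZeroDivisors_of_ne_zero (by omega)⟩, by
        simpa [Submonoid.smul_def] using hkT⟩
    rw [map_add, h0, zero_add, map_add, ← two_zsmul]
    exact Submodule.smul_mem_smul (Ideal.mem_span_singleton_self 2) trivial
  -- Modulo torsion the group equals its double, so Nakayama provides an odd integer r that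
  -- annihilates the quotient.
  obtain ⟨r, hr, hr0⟩ := Submodule.exists_sub_one_mem_and_smul_eq_zero_of_fg_of_le_smul
    (Ideal.span {(2 : ℤ)}) (⊤ : Submodule ℤ N) Module.Finite.fg_top hle
  have hrne : r ≠ 0 := by
    rintro rfl
    rw [Ideal.mem_span_singleton] at hr
    omega
  have hP := hr0 ((Submodule.torsion ℤ G).mkQ P) trivial
  rw [← map_smul, Submodule.mkQ_apply, Submodule.Quotient.mk_eq_zero,
    Submodule.mem_torsion_iff] at hP
  obtain ⟨a, ha⟩ := hP
  rw [Submonoid.smul_def, smul_smul] at ha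
  exact isOfFinAddOrder_iff_zsmul_eq_zero.mpr
    ⟨_, mul_ne_zero (nonZeroDivisors.ne_zero a.2) hrne, ha⟩

/-- The finite torsion subgroup surjects onto the quotient by doubles, which gives finite index and
then finite generation. -/
theorem isOfFinAddOrder_rat (P : (curveE ℚ).toAffine.Point) : IsOfFinAddOrder P := by
  have hfin := finite_setOf_isOfFinAddOrder (W := curveE ℚ) rfl rfl
  have hindex : (nsmulAddMonoidHom (α := (curveE ℚ).toAffine.Point) 2).range.FiniteIndex := by
    have := hfin.to_subtype
    refine AddSubgroup.finiteIndex_iff_finite_quotient.mpr ?_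
    refine Finite.of_surjective (fun T : {P : (curveE ℚ).toAffine.Point | IsOfFinAddOrder P} =>
      (QuotientAddGroup.mk (T : (curveE ℚ).toAffine.Point))) fun q => ?_
    obtain ⟨P, rfl⟩ := QuotientAddGroup.mk_surjective q
    obtain ⟨T, Q, hT, rfl⟩ := exists_torsion_add_double_rat P
    refine ⟨⟨T, hT⟩, ?_⟩
    rw [QuotientAddGroup.eq, neg_add_cancel_left]
    exact ⟨Q, by simp [two_nsmul]⟩
  have := addGroup_fg_of_finiteIndex (W := curveE ℚ) rfl rfl hindex
  exact isOfFinAddOrder_of_fg exists_torsion_add_double_rat P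

end RationalPoints

end FourSquares

namespace FourSquares

open WeierstrassCurve WeierstrassCurve.Affine

/-! ### p-adic absolute values -/

section PadicAbv

variable {F : Type*} [Field F] {p : ℕ} [Fact p.Prime]

/-- The absolute value on a field induced by an embedding into the `p`-adic numbers. -/
noncomputable def padicAbv (ι : F →+* ℚ_[p]) : AbsoluteValue F ℝ where
  toFun x := ‖ι x‖
  map_mul' := by simp
  nonneg' _ := norm_nonneg _
  eq_zero' := by simp
  add_le' x y := by simpa using norm_add_le (ι x) (ι y)

theorem padicAbv_apply (ι : F →+* ℚ_[p]) (x : F) : padicAbv ι x = ‖ι x‖ := rfl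

theorem isNonarchimedean_padicAbv (ι : F →+* ℚ_[p]) : IsNonarchimedean (padicAbv ι) := fun x y => by
  simpa [padicAbv_apply] using Padic.nonarchimedean (ι x) (ι y)

theorem padicAbv_intCast_le_one (ι : F →+* ℚ_[p]) (n : ℤ) : padicAbv ι n ≤ 1 := by
  simpa [padicAbv_apply] using Padic.norm_int_le_one (p := p) n

theorem padicAbv_two (ι : F →+* ℚ_[2]) : padicAbv ι 2 = 1 / 2 := by
  have := Padic.norm_p (p := 2)
  rw [padicAbv_apply, map_ofNat]
  norm_num at this ⊢
  exact this

end PadicAbv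

/-- An infinite family of points in a compact metric space contains two members that are
arbitrarily close to each other. -/
theorem exists_ne_dist_lt {X : Type*} [PseudoMetricSpace X] [CompactSpace X] {I : Set ℕ}
    (hI : I.Infinite) (f : ℕ → X) {ε : ℝ} (hε : 0 < ε) :
    ∃ i ∈ I, ∃ j ∈ I, i < j ∧ dist (f i) (f j) < ε := by
  obtain ⟨t, -, ht, hcov⟩ := (isCompact_univ (X := X)).finite_cover_balls (half_pos hε)
  have hc : ∀ i, ∃ c ∈ t, f i ∈ Metric.ball c (ε / 2) := fun i => by
    simpa using hcov (Set.mem_univ (f i))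
  choose c hct hc using hc
  obtain ⟨i, hi, j, hj, hij, e⟩ :=
    hI.exists_ne_map_eq_of_mapsTo (f := c) (fun i _ => hct i) ht
  have hdist : dist (f i) (f j) < ε := by
    have h1 := Metric.mem_ball.mp (hc i)
    have h2 := Metric.mem_ball'.mp (hc j)
    rw [← e] at h2
    linarith [dist_triangle (f i) (c i) (f j)]
  rcases lt_or_gt_of_ne hij with h | h
  · exact ⟨i, hi, j, hj, h, hdist⟩
  · exact ⟨j, hj, i, hi, h, by rwa [dist_comm]⟩

/-! ### Multiples of the point on the fiber curve -/

section FiberCurve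

/-- The curve `y² = x³ - 10 x² + 88 x - 108`, whose rational points parametrize the lines
`y = x + n` that meet the curve `y² = x (x + 3) (x - 1)` in a cyclic cubic point. -/
def fiberCurve (F : Type*) [Field F] : WeierstrassCurve F :=
  { a₁ := 0, a₂ := -10, a₃ := 0, a₄ := 88, a₆ := -108 }

theorem fiberCurve_equation_iff {F : Type*} [Field F] {x y : F} :
    (fiberCurve F).toAffine.Equation x y ↔ y ^ 2 = x ^ 3 - 10 * x ^ 2 + 88 * x - 108 := by
  rw [equation_iff_of_short rfl rfl]
  simp only [fiberCurve]
  ring_nf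

theorem fiberCurve_nonsingular : (fiberCurve ℚ).toAffine.Nonsingular 2 6 := by
  rw [nonsingular_iff]
  refine ⟨fiberCurve_equation_iff.mpr (by norm_num), Or.inr ?_⟩
  norm_num [fiberCurve]

/-- A rational point of infinite order on the fiber curve. -/
noncomputable def fiberPoint : (fiberCurve ℚ).toAffine.Point := .some 2 6 fiberCurve_nonsingular

theorem isShortIntegral_fiberCurve {F : Type*} [Field F] {p : ℕ} [Fact p.Prime] (ι : F →+* ℚ_[p]) :
    IsShortIntegral (fiberCurve F) (padicAbv ι) where
  nonarch := isNonarchimedean_padicAbv ι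
  a₁ := rfl
  a₃ := rfl
  a₂ := by
    refine ((padicAbv ι).map_neg 10).trans_le ?_
    exact_mod_cast padicAbv_intCast_le_one ι 10
  a₄ := by exact_mod_cast padicAbv_intCast_le_one ι 88
  a₆ := by
    refine ((padicAbv ι).map_neg 108).trans_le ?_
    exact_mod_cast padicAbv_intCast_le_one ι 108

theorem isShortIntegral_curveE {F : Type*} [Field F] {p : ℕ} [Fact p.Prime] (ι : F →+* ℚ_[p]) :
    IsShortIntegral (curveE F) (padicAbv ι) where
  nonarch := isNonarchimedean_padicAbv ι
  a₁ := rfl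
  a₃ := rfl
  a₂ := by exact_mod_cast padicAbv_intCast_le_one ι 2
  a₄ := by
    refine ((padicAbv ι).map_neg 3).trans_le ?_
    exact_mod_cast padicAbv_intCast_le_one ι 3
  a₆ := by exact_mod_cast padicAbv_intCast_le_one ι 0

theorem fiberPoint_double :
    ∃ h, fiberPoint + fiberPoint = Point.some (31 : ℚ) (-151) h := by
  obtain ⟨x, y, h, e, hx, hy⟩ := add_self_of_Y_ne_zero (W := fiberCurve ℚ) rfl rfl two_ne_zero
    fiberCurve_nonsingular (by norm_num)
  have hx' : x = 31 := by rw [hx]; norm_num [fiberCurve]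
  have hy' : y = -151 := by rw [hy, hx']; norm_num [fiberCurve]
  subst hx' hy'
  exact ⟨h, e⟩

/-- The fourth multiple has first coordinate with denominator `302 ^ 2`, so it lies in the
torsion-free kernel of reduction at 2. -/
theorem nsmul_fiberPoint_ne_zero {n : ℕ} (hn : n ≠ 0) : n • fiberPoint ≠ 0 := by
  obtain ⟨h, e⟩ := fiberPoint_double
  obtain ⟨x, y, h', e', hx, -⟩ := add_self_of_Y_ne_zero (W := fiberCurve ℚ) rfl rfl two_ne_zero
    h (by norm_num)
  have h4 : 4 • fiberPoint = Point.some x y h' := by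
    rw [show 4 = 2 * 2 by norm_num, mul_nsmul, two_nsmul, two_nsmul, e, e']
  have hx' : x = 784593 / 91204 := by rw [hx]; norm_num [fiberCurve]
  have hval : 1 < padicAbv (Rat.castHom ℚ_[2]) x := by
    have h1 : padicAbv (Rat.castHom ℚ_[2]) 784593 = 1 := by
      have := (Padic.norm_natCast_eq_one_iff (p := 2) (n := 784593)).mpr (by norm_num)
      rw [padicAbv_apply, map_ofNat]
      exact_mod_cast this
    have h2 : padicAbv (Rat.castHom ℚ_[2]) 22801 = 1 := by
      have := (Padic.norm_natCast_eq_one_iff (p := 2) (n := 22801)).mpr (by norm_num)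
      rw [padicAbv_apply, map_ofNat]
      exact_mod_cast this
    rw [hx', show (784593 / 91204 : ℚ) = 784593 / (2 * 2 * 22801) by norm_num, map_div₀, map_mul,
      map_mul, h1, h2, padicAbv_two]
    norm_num
  have := (isShortIntegral_fiberCurve (Rat.castHom ℚ_[2])).nsmul_ne_zero_of_reducesToZero
    (A := 4 • fiberPoint) (by rw [padicAbv_two]; norm_num) two_ne_zero (by rw [h4]; exact hval)
    (by rw [h4]; exact Point.some_ne_zero _) hn
  rw [smul_comm] at this
  exact fun h0 => this (by rw [h0, smul_zero])

/-- The chord through the first point and the negative of the second has slope `(y₁ + y₂) / (x₁ -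
x₂)`, also equal to a difference quotient of the cubic divided by `y₁ - y₂` when `y₁ ≠ y₂`. One of
the numerators is not small, so the slope is large. -/
theorem reducesToZero_sub_of_close {v : AbsoluteValue ℚ ℝ} (hW : IsShortIntegral (fiberCurve ℚ) v)
    (hint : ∀ n : ℤ, v n ≤ 1) {x₁ y₁ x₂ y₂ : ℚ} (h₁ : (fiberCurve ℚ).toAffine.Nonsingular x₁ y₁)
    (h₂ : (fiberCurve ℚ).toAffine.Nonsingular x₂ y₂) (hx₁ : v x₁ ≤ 1) (hx₂ : v x₂ ≤ 1)
    (hne : x₁ ≠ x₂) (hx : v (x₁ - x₂) < v (2 * 246924)) (hy : v (y₁ - y₂) < v (2 * 246924)) :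
    ReducesToZero v (Point.some x₁ y₁ h₁ - Point.some x₂ y₂ h₂) := by
  obtain ⟨h₂', e₂⟩ := neg_some_eq (W := fiberCurve ℚ) rfl rfl h₂
  obtain ⟨x₃, y₃, h₃, e₃, hx₃, -⟩ := add_some_of_X_ne (W := fiberCurve ℚ) rfl rfl h₁ h₂' hne
  rw [sub_eq_add_neg, e₂, e₃, reducesToZero_some]
  have q₁ := fiberCurve_equation_iff.mp h₁.1
  have q₂ := fiberCurve_equation_iff.mp h₂.1
  have hs := sub_ne_zero.mpr hne
  have hv := hW.nonarch
  have vy₁ := hW.abv_Y_le_one h₁.1 hx₁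
  have i2 : v 2 ≤ 1 := by exact_mod_cast hint 2
  have hD2 : v (2 * 246924) ≤ v 246924 := by
    rw [v.map_mul]; exact mul_le_of_le_one_left (v.nonneg _) i2
  set l := (y₁ - -y₂) / (x₁ - x₂) with hl
  have hl' : l * (x₁ - x₂) = y₁ + y₂ := by rw [hl]; field_simp; ring
  set f' := 3 * x₁ ^ 2 - 20 * x₁ + 88 with hf'
  -- A Bézout identity between the cubic and its derivative; 246924 is a quarter of the discriminant
  -- up to sign. Thus `y₁` and `f'` are not both small.
  have bez : (1571 - 246 * x₁) * y₁ * y₁ + (4734 - 797 * x₁ + 82 * x₁ ^ 2) * f' = 246924 := by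
    rw [hf']; linear_combination (1571 - 246 * x₁) * q₁
  have ib : ∀ (n : ℤ) {z : ℚ}, v z ≤ 1 → v (n * z) ≤ 1 := fun n z hz =>
    abv_mul_le_one (hint n) hz
  have c1 : v (1571 - 246 * x₁) ≤ 1 :=
    abv_sub_le_of_le hv (by exact_mod_cast hint 1571) (by exact_mod_cast ib 246 hx₁)
  have c2 : v (4734 - 797 * x₁ + 82 * x₁ ^ 2) ≤ 1 :=
    abv_add_le_of_le hv (abv_sub_le_of_le hv (by exact_mod_cast hint 4734)
      (by exact_mod_cast ib 797 hx₁)) (by exact_mod_cast ib 82 (abv_pow_le_one hx₁ 2))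
  have hl1 : 1 < v l := by
    have hmax : v 246924 ≤ max (v y₁) (v f') := by
      rw [← bez]
      refine (hv _ _).trans (max_le_max ?_ ?_)
      · rw [v.map_mul]
        exact mul_le_of_le_one_left (v.nonneg _) (abv_mul_le_one c1 vy₁)
      · rw [v.map_mul]
        exact mul_le_of_le_one_left (v.nonneg _) c2
    rcases le_max_iff.mp hmax with hcase | hcase
    · have e1 : v (2 * 246924) ≤ v (2 * y₁) := by
        rw [v.map_mul, v.map_mul]
        exact mul_le_mul_of_nonneg_left hcase (v.nonneg _)
      have e2 : v (y₁ + y₂) = v (2 * y₁) := by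
        rw [show y₁ + y₂ = 2 * y₁ + -(y₁ - y₂) by ring, abv_add_eq_left hv]
        rw [v.map_neg]; linarith
      have e3 : v l * v (x₁ - x₂) = v (y₁ + y₂) := by rw [← v.map_mul, hl']
      have hpos := v.pos hs
      by_contra! hle
      nlinarith [mul_le_of_le_one_left hpos.le hle]
    · set g := f' + -(x₁ - x₂) * (2 * x₁ + x₂ - 10) with hg
      have hgl : l * (y₁ - y₂) = g := by
        apply mul_left_cancel₀ hs
        rw [hg, hf']
        linear_combination (y₁ - y₂) * hl' + q₁ - q₂
      have vg : v g = v f' := by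
        rw [hg, abv_add_eq_left hv]
        rw [v.map_mul, v.map_neg]
        have : v (2 * x₁ + x₂ - 10) ≤ 1 :=
          abv_sub_le_of_le hv (abv_add_le_of_le hv (by exact_mod_cast ib 2 hx₁) hx₂)
            (by exact_mod_cast hint 10)
        nlinarith [v.nonneg (x₁ - x₂)]
      have e3 : v l * v (y₁ - y₂) = v f' := by rw [← v.map_mul, hgl, vg]
      by_contra! hle
      nlinarith [mul_le_of_le_one_left (v.nonneg (y₁ - y₂)) hle]
  have hl2 : 1 < v (l ^ 2) := by rw [map_pow]; exact one_lt_pow₀ hl1 two_ne_zero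
  have : x₃ = l ^ 2 + (10 - x₁ - x₂) := by
    rw [hx₃]; simp only [fiberCurve]; ring
  rw [this, abv_add_eq_left hv]
  · exact hl2
  · refine lt_of_le_of_lt ?_ hl2
    exact abv_sub_le_of_le hv (abv_sub_le_of_le hv (by exact_mod_cast hint 10) hx₁) hx₂

/-- By compactness of ℤ_p × ℤ_p two integral multiples are very close, and their difference lies in
the kernel. -/
theorem exists_nsmul_reducesToZero (p : ℕ) [Fact p.Prime] :
    ∃ M : ℕ, 0 < M ∧ ReducesToZero (padicAbv (Rat.castHom ℚ_[p])) (M • fiberPoint) := by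
  set v := padicAbv (Rat.castHom ℚ_[p]) with hvdef
  have hW := isShortIntegral_fiberCurve (Rat.castHom ℚ_[p])
  rw [← hvdef] at hW
  have hint : ∀ n : ℤ, v n ≤ 1 := padicAbv_intCast_le_one _
  let I : Set ℕ := {j | ¬ ReducesToZero v (j • fiberPoint)}
  have h1 : ¬ ReducesToZero v fiberPoint := by
    change ¬ (1 < v 2)
    rw [not_lt]
    exact_mod_cast hint 2
  -- Two consecutive multiples cannot both lie in the kernel, as their difference `fiberPoint` does
  -- not.
  have hI : I.Infinite := by
    refine Set.infinite_of_forall_exists_gt fun j => ?_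
    by_cases hj : ReducesToZero v ((j + 1) • fiberPoint)
    · refine ⟨j + 2, ?_, by omega⟩
      change ¬ ReducesToZero v ((j + 1 + 1) • fiberPoint)
      rw [succ_nsmul]
      exact hW.not_reducesToZero_add hj h1
    · exact ⟨j + 1, hj, by omega⟩
  -- Outside I the coordinates are set to 0, so that the sequence is total.
  have coords : ∀ j, ∃ X Y : ℤ_[p], j ∈ I → ∃ x y h, j • fiberPoint = Point.some x y h ∧
      v x ≤ 1 ∧ (X : ℚ_[p]) = x ∧ (Y : ℚ_[p]) = y := by
    intro j
    by_cases hj : j ∈ I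
    · have hj' : ¬ ReducesToZero v (j • fiberPoint) := hj
      generalize j • fiberPoint = P at hj'
      match P with
      | 0 => simp at hj'
      | .some x y h =>
        rw [reducesToZero_some, not_lt] at hj'
        exact ⟨⟨x, hj'⟩, ⟨y, hW.abv_Y_le_one h.1 hj'⟩, fun _ => ⟨x, y, h, rfl, hj', rfl, rfl⟩⟩
    · exact ⟨0, 0, fun h => absurd h hj⟩
  choose X Y hXY using coords
  have hε : 0 < v (2 * 246924) := v.pos (by norm_num)
  obtain ⟨i, hi, j, hj, hij, hdist⟩ := exists_ne_dist_lt hI (fun j => (X j, Y j)) hε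
  obtain ⟨x₁, y₁, h₁, e₁, i₁, hX₁, hY₁⟩ := hXY i hi
  obtain ⟨x₂, y₂, h₂, e₂, i₂, hX₂, hY₂⟩ := hXY j hj
  rw [Prod.dist_eq, max_lt_iff, dist_comm, dist_eq_norm, dist_comm, dist_eq_norm,
    PadicInt.norm_def, PadicInt.norm_def, PadicInt.coe_sub, PadicInt.coe_sub, hX₁, hX₂,
    hY₁, hY₂] at hdist
  have hne : x₂ ≠ x₁ := by
    intro h
    rcases Point.X_eq_iff (h₁ := h₂) (h₂ := h₁).mp h with h | h
    · rw [← e₁, ← e₂] at h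
      refine nsmul_fiberPoint_ne_zero (n := j - i) (by omega) ?_
      rw [sub_nsmul _ hij.le, h, add_neg_cancel]
    · rw [← e₁, ← e₂] at h
      refine nsmul_fiberPoint_ne_zero (n := j + i) (by omega) ?_
      rw [add_nsmul, h, neg_add_cancel]
  refine ⟨j - i, by omega, ?_⟩
  rw [sub_nsmul _ hij.le, e₁, e₂, ← sub_eq_add_neg]
  refine reducesToZero_sub_of_close hW hint h₂ h₁ i₂ i₁ hne ?_ ?_
  · rw [hvdef, padicAbv_apply (Rat.castHom ℚ_[p]) (x₂ - x₁)]
    simpa using hdist.1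
  · rw [hvdef, padicAbv_apply (Rat.castHom ℚ_[p]) (y₂ - y₁)]
    simpa using hdist.2

theorem exists_nsmul_reducesToZero_of_finite (S : Finset Nat.Primes) :
    ∃ M : ℕ, 0 < M ∧ ∀ p ∈ S, haveI : Fact (p : ℕ).Prime := ⟨p.2⟩
      ReducesToZero (padicAbv (Rat.castHom ℚ_[p])) (M • fiberPoint) := by
  have : ∀ p : Nat.Primes, ∃ M : ℕ, 0 < M ∧ haveI : Fact (p : ℕ).Prime := ⟨p.2⟩
      ReducesToZero (padicAbv (Rat.castHom ℚ_[p])) (M • fiberPoint) := fun p =>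
    haveI : Fact (p : ℕ).Prime := ⟨p.2⟩
    exists_nsmul_reducesToZero p
  choose M hM hr using this
  refine ⟨∏ p ∈ S, M p, Finset.prod_pos fun p _ => hM p, fun p hp => ?_⟩
  have : Fact (p : ℕ).Prime := ⟨p.2⟩
  obtain ⟨k, hk⟩ := Finset.dvd_prod_of_mem M hp
  rw [hk, mul_nsmul]
  exact (isShortIntegral_fiberCurve (Rat.castHom ℚ_[p])).reducesToZero_nsmul (hr p) k

end FiberCurve

end FourSquares

namespace FourSquares

open WeierstrassCurve WeierstrassCurve.Affine Polynomial

/-! ### The cubics cut out by the lines `y = x + n` -/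

section Slicing

/-- The discriminant of the cubic polynomial `X³ + X² - (3 + 2n) X - n²`. -/
def sliceDisc {F : Type*} [Field F] (n : F) : F :=
  (3 + 2 * n) ^ 2 + 4 * (3 + 2 * n) ^ 3 + 4 * n ^ 2 + 18 * (3 + 2 * n) * n ^ 2 - 27 * n ^ 4

/-- If the discriminant is a nonzero square, the cubic splits as soon as it has a root. -/
theorem exists_other_roots {F : Type*} [Field F] [CharZero F] {n d r : F}
    (hd : d ^ 2 = sliceDisc n) (hd0 : d ≠ 0)
    (hr : r ^ 3 + r ^ 2 - (3 + 2 * n) * r - n ^ 2 = 0) :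
    ∃ s t : F, r + s + t = -1 ∧ r * s + r * t + s * t = -(3 + 2 * n) ∧ r * s * t = n ^ 2 := by
  set g := 3 * r ^ 2 + 2 * r - (3 + 2 * n) with hg
  -- Here g is the derivative at r; the discriminant of the cubic is `g ^ 2` times that of the
  -- quadratic cofactor.
  have key : g ^ 2 * ((1 + r) ^ 2 - 4 * (r ^ 2 + r - 3 - 2 * n)) = d ^ 2 := by
    rw [hd, hg, sliceDisc]
    linear_combination (-27 * r ^ 3 - 27 * r ^ 2 + 81 * r + 54 * n * r + 58 + 36 * n - 27 * n ^ 2) * hr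
  have hg0 : g ≠ 0 := by
    intro h
    rw [h] at key
    exact hd0 (pow_eq_zero_iff two_ne_zero |>.mp (by linear_combination -key))
  set e := d / g with he
  have he' : e ^ 2 = (1 + r) ^ 2 - 4 * (r ^ 2 + r - 3 - 2 * n) := by
    rw [he, div_pow, ← key]
    field_simp
  refine ⟨(-1 - r + e) / 2, (-1 - r - e) / 2, by ring, ?_, ?_⟩
  · linear_combination -he' / 4
  · linear_combination hr - r * he' / 4

theorem abv_eight {F : Type*} [Field F] (ι : F →+* ℚ_[2]) : padicAbv ι 8 = 1 / 8 := by
  rw [show (8 : F) = 2 ^ 3 by norm_num, map_pow, padicAbv_two]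
  norm_num

/-- The point `(1 - e, 1 - e + n)` is 2-adically close to `(1, 0)`; its double has first coordinate
of size `1 / v e`, so it lies in the kernel of reduction. -/
theorem not_isOfFinAddOrder_of_root {F : Type*} [Field F] [CharZero F] [DecidableEq F]
    (ι : F →+* ℚ_[2]) {n e : F} (he : padicAbv ι e < 1 / 4) (he0 : e ≠ 0)
    (hr : (1 - e) ^ 3 + (1 - e) ^ 2 - (3 + 2 * n) * (1 - e) - n ^ 2 = 0) :
    ∃ P : (curveE F).toAffine.Point, ¬ IsOfFinAddOrder P := by
  set v := padicAbv ι with hv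
  have hna : IsNonarchimedean v := isNonarchimedean_padicAbv ι
  have h2 : v 2 = 1 / 2 := padicAbv_two ι
  have h4 : v 4 = 1 / 4 := by
    rw [show (4 : F) = 2 ^ 2 by norm_num, map_pow, h2]; norm_num
  have v1 : v (1 - e) = 1 := by
    rw [sub_eq_add_neg, abv_add_eq_left hna, v.map_one]
    rw [v.map_neg, v.map_one]; linarith
  have v4 : v (4 - e) = 1 / 4 := by
    rw [sub_eq_add_neg, abv_add_eq_left hna, h4]
    rw [v.map_neg, h4]; exact he
  have vn : v ((1 - e) ^ 2 + 3) = 1 / 4 := by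
    rw [show (1 - e) ^ 2 + 3 = 4 + e * (e - 2) by ring, abv_add_eq_left hna, h4]
    rw [h4, v.map_mul]
    have : v (e - 2) ≤ 1 := abv_sub_le_of_le hna (by linarith) (by rw [h2]; norm_num)
    exact (mul_le_of_le_one_right (v.nonneg _) this).trans_lt he
  have ve := v.pos he0
  have heq : ((1 - e) + n) ^ 2 = (1 - e) * ((1 - e) + 3) * ((1 - e) - 1) := by
    linear_combination -hr
  have vy : v ((1 - e) + n) ^ 2 = 1 / 4 * v e := by
    rw [← map_pow, heq, show (1 - e) * ((1 - e) + 3) * ((1 - e) - 1) = -((1 - e) * (4 - e) * e) by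
      ring, v.map_neg, v.map_mul, v.map_mul, v1, v4, one_mul]
  have hy : (1 - e) + n ≠ 0 := by
    intro h
    rw [h, v.map_zero] at vy
    nlinarith
  obtain ⟨X, Y, h', e', hX, -⟩ := curveE_double (curveE_nonsingular_iff.mpr heq) hy
  have hvX : 1 < v X := by
    rw [hX, map_pow, map_div₀, v.map_mul, h2, vn, div_pow, mul_pow, vy, lt_div_iff₀ (by positivity)]
    linarith
  refine ⟨Point.some X Y h', ?_⟩
  rw [isOfFinAddOrder_iff_nsmul_eq_zero]
  rintro ⟨k, hk, hk0⟩
  refine (isShortIntegral_curveE ι).nsmul_ne_zero_of_reducesToZero (A := Point.some X Y h')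
    (by rw [← hv, h2]; norm_num) two_ne_zero hvX (Point.some_ne_zero _) hk.ne' hk0

/-- The values `1 - z` at the three roots multiply to `-(n + 1) ^ 2`, of size below 1/64, so one of
them is below 1/4. -/
theorem exists_not_isOfFinAddOrder {F : Type*} [Field F] [CharZero F] [DecidableEq F]
    (ι : F →+* ℚ_[2]) {n d r : F} (hd : d ^ 2 = sliceDisc n) (hd0 : d ≠ 0)
    (hn : padicAbv ι (n + 1) < padicAbv ι 8) (hn0 : n + 1 ≠ 0)
    (hr : r ^ 3 + r ^ 2 - (3 + 2 * n) * r - n ^ 2 = 0) :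
    ∃ P : (curveE F).toAffine.Point, ¬ IsOfFinAddOrder P := by
  obtain ⟨s, t, e1, e2, e3⟩ := exists_other_roots hd hd0 hr
  set v := padicAbv ι with hv
  rw [hv, abv_eight ι, ← hv] at hn
  have hprod : (1 - r) * (1 - s) * (1 - t) = -(n + 1) ^ 2 := by
    linear_combination e2 - e1 - e3
  have hne : (1 - r) * (1 - s) * (1 - t) ≠ 0 := by
    rw [hprod]; exact neg_ne_zero.mpr (pow_ne_zero 2 hn0)
  have hlt : v (1 - r) * v (1 - s) * v (1 - t) < 1 / 64 := by
    rw [← v.map_mul, ← v.map_mul, hprod, v.map_neg, map_pow]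
    nlinarith [v.nonneg (n + 1)]
  have root : ∀ z, (z - r) * (z - s) * (z - t) = 0 →
      z ^ 3 + z ^ 2 - (3 + 2 * n) * z - n ^ 2 = 0 := by
    intro z hz
    linear_combination hz + z ^ 2 * e1 - z * e2 + e3
  have finish : ∀ z, (z - r) * (z - s) * (z - t) = 0 → 1 - z ≠ 0 → v (1 - z) < 1 / 4 →
      ∃ P : (curveE F).toAffine.Point, ¬ IsOfFinAddOrder P := fun z hz hz0 hvz =>
    not_isOfFinAddOrder_of_root ι (n := n) hvz hz0 (by rw [sub_sub_cancel]; exact root z hz)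
  have hne' := mul_ne_zero_iff.mp hne
  have hne'' := mul_ne_zero_iff.mp hne'.1
  by_contra! hcon
  have b : ∀ z, (z - r) * (z - s) * (z - t) = 0 → 1 - z ≠ 0 → 1 / 4 ≤ v (1 - z) := by
    intro z hz hz0
    by_contra! hlt
    obtain ⟨P, hP⟩ := finish z hz hz0 hlt
    exact hP (hcon P)
  have b1 := b r (by ring) hne''.1
  have b2 := b s (by ring) hne''.2
  have b3 := b t (by ring) hne'.2
  have b4 : 1 / 4 * (1 / 4) ≤ v (1 - r) * v (1 - s) := by gcongr
  have b5 : 1 / 4 * (1 / 4) * (1 / 4) ≤ v (1 - r) * v (1 - s) * v (1 - t) := by gcongr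
  linarith

/-- Hensel at 1: the cubic takes the value `-(n + 1) ^ 2` there, and its derivative `4 - 2(n + 1)`
has the size of 4. -/
theorem exists_padic_root {p : ℕ} [Fact p.Prime] {n : ℚ_[p]} (hn : ‖n + 1‖ < ‖(8 : ℚ_[p])‖) :
    ∃ r : ℚ_[p], r ^ 3 + r ^ 2 - (3 + 2 * n) * r - n ^ 2 = 0 := by
  have hint : ∀ k : ℕ, ‖(k : ℚ_[p])‖ ≤ 1 := fun k => by
    exact_mod_cast Padic.norm_int_le_one (p := p) k
  have h8 : ‖(8 : ℚ_[p])‖ ≤ 1 := by exact_mod_cast hint 8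
  have h2 : ‖(2 : ℚ_[p])‖ ≤ 1 := by exact_mod_cast hint 2
  have h20 : 0 < ‖(2 : ℚ_[p])‖ := norm_pos_iff.mpr two_ne_zero
  have e8 : ‖(8 : ℚ_[p])‖ = ‖(2 : ℚ_[p])‖ ^ 3 := by rw [← norm_pow]; norm_num
  have e4 : ‖(4 : ℚ_[p])‖ = ‖(2 : ℚ_[p])‖ ^ 2 := by rw [← norm_pow]; norm_num
  let m : ℤ_[p] := ⟨n + 1, hn.le.trans h8⟩
  have hm : (m : ℚ_[p]) = n + 1 := rfl
  have c2 : ((2 : ℤ_[p]) : ℚ_[p]) = 2 := map_ofNat PadicInt.Coe.ringHom 2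
  have c4 : ((4 : ℤ_[p]) : ℚ_[p]) = 4 := map_ofNat PadicInt.Coe.ringHom 4
  obtain ⟨a, ha⟩ : ∃ a : ℤ_[p], a = 1 + 2 * m := ⟨_, rfl⟩
  obtain ⟨b, hb⟩ : ∃ b : ℤ_[p], b = (m - 1) ^ 2 := ⟨_, rfl⟩
  let F : ℤ_[p][X] := X ^ 3 + X ^ 2 - C a * X - C b
  have hF : ∀ z : ℤ_[p], F.aeval z = z ^ 3 + z ^ 2 - (1 + 2 * m) * z - (m - 1) ^ 2 := fun z => by
    simp [F, ha, hb]
  have hF' : F.derivative.aeval (1 : ℤ_[p]) = 4 - 2 * m := by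
    simp [F, ha]; ring
  have hnorm : ‖F.aeval (1 : ℤ_[p])‖ < ‖F.derivative.aeval (1 : ℤ_[p])‖ ^ 2 := by
    have a1 : ‖F.aeval (1 : ℤ_[p])‖ = ‖n + 1‖ ^ 2 := by
      rw [hF, show (1 : ℤ_[p]) ^ 3 + 1 ^ 2 - (1 + 2 * m) * 1 - (m - 1) ^ 2 = -m ^ 2 by ring,
        norm_neg, norm_pow, PadicInt.norm_def, hm]
    have a2 : ‖F.derivative.aeval (1 : ℤ_[p])‖ = ‖(2 : ℚ_[p])‖ ^ 2 := by
      rw [hF', PadicInt.norm_def, PadicInt.coe_sub, PadicInt.coe_mul, c2, c4]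
      have : ‖(2 : ℚ_[p]) * m‖ < ‖(4 : ℚ_[p])‖ := by
        rw [norm_mul, hm, e4]
        have : ‖(2 : ℚ_[p])‖ ^ 3 ≤ ‖(2 : ℚ_[p])‖ ^ 1 :=
          pow_le_pow_of_le_one h20.le h2 (by norm_num)
        rw [e8] at hn
        nlinarith
      rw [sub_eq_add_neg, Padic.add_eq_max_of_ne (by rw [norm_neg]; exact this.ne'), norm_neg,
        max_eq_left this.le, e4]
    rw [a1, a2]
    rw [e8] at hn
    have : ‖(2 : ℚ_[p])‖ ^ 3 ≤ ‖(2 : ℚ_[p])‖ ^ 2 := pow_le_pow_of_le_one h20.le h2 (by norm_num)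
    exact pow_lt_pow_left₀ (hn.trans_le this) (norm_nonneg _) two_ne_zero
  obtain ⟨z, hz, -⟩ := hensels_lemma hnorm
  rw [hF] at hz
  refine ⟨z, ?_⟩
  have := congrArg (fun w : ℤ_[p] => (w : ℚ_[p])) hz
  push_cast at this
  rw [hm, c2] at this
  linear_combination this

end Slicing

end FourSquares

/-! ### Ramification obstructs p-adic embeddings -/

namespace FourSquares

open NumberField

theorem norm_le_one_of_isIntegral {p : ℕ} [Fact p.Prime] {x : ℚ_[p]} (hx : IsIntegral ℤ x) :
    ‖x‖ ≤ 1 := by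
  obtain ⟨y, rfl⟩ := IsIntegrallyClosed.isIntegral_iff.mp (hx.tower_top (A := ℤ_[p]))
  exact y.2

/-- A Galois number field other than `ℚ` has no embedding into `ℚ_p` for some prime `p`. -/
theorem exists_prime_isEmpty_ringHom (K : Type*) [Field K] [NumberField K] [IsGalois ℚ K]
    (hK : 1 < Module.finrank ℚ K) :
    ∃ p : Nat.Primes, haveI : Fact (p : ℕ).Prime := ⟨p.2⟩; IsEmpty (K →+* ℚ_[p]) := by
  obtain ⟨p, hp, hram⟩ :=
    NumberField.exists_not_isUnramifiedAt_int_of_isGalois (K := K) (𝒪 := 𝓞 K) hK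
  refine ⟨⟨p, hp⟩, ⟨fun ι => ?_⟩⟩
  have : Fact p.Prime := ⟨hp⟩
  change K →+* ℚ_[p] at ι
  let i : 𝓞 K →+* ℚ_[p] := ι.comp (algebraMap (𝓞 K) K)
  let j : 𝓞 K →+* ℤ_[p] :=
    { toFun x := ⟨i x, norm_le_one_of_isIntegral (x.isIntegral_coe.map ι.toIntAlgHom)⟩
      map_one' := Subtype.ext (map_one i)
      map_mul' _ _ := Subtype.ext (map_mul i _ _)
      map_zero' := Subtype.ext (map_zero i)
      map_add' _ _ := Subtype.ext (map_add i _ _) }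
  -- An embedding singles out a prime P above p. All primes above p ramify, so `p ∈ P ^ 2`, whose
  -- image would put p into `p ^ 2 ℤ_p`.
  let P : Ideal (𝓞 K) := (IsLocalRing.maximalIdeal ℤ_[p]).comap j
  have hPp : P.IsPrime := inferInstance
  have hpP : (p : 𝓞 K) ∈ P := by
    rw [Ideal.mem_comap, map_natCast, PadicInt.maximalIdeal_eq_span_p]
    exact Ideal.mem_span_singleton_self _
  have h1 : P.ramificationIdx ℤ ≠ 1 := fun h =>
    hram P hPp hpP (Ideal.ramificationIdx_eq_one_iff.mp h)
  have hunder : P.under ℤ ≠ ⊥ := fun h => by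
    have : (p : ℤ) ∈ P.under ℤ := by
      rw [Ideal.under, Ideal.mem_comap]; simpa using hpP
    rw [h, Ideal.mem_bot] at this
    exact hp.ne_zero (by exact_mod_cast this)
  rw [← Ideal.ramificationIdx'_eq_ramificationIdx (P.under ℤ) P hunder,
    Ideal.ramificationIdx'_ne_one_iff Ideal.map_comap_le] at h1
  have h2 : (p : 𝓞 K) ∈ P ^ 2 := by
    have : (p : ℤ) ∈ P.under ℤ := by
      rw [Ideal.under, Ideal.mem_comap]; simpa using hpP
    simpa using h1 (Ideal.mem_map_of_mem _ this)
  have h3 : ((p : ℕ) : ℤ_[p]) ∈ IsLocalRing.maximalIdeal ℤ_[p] ^ 2 := by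
    have := Ideal.mem_map_of_mem j h2
    rw [Ideal.map_pow, map_natCast] at this
    exact Ideal.pow_right_mono Ideal.map_comap_le 2 this
  rw [PadicInt.maximalIdeal_eq_span_p, Ideal.span_singleton_pow, Ideal.mem_span_singleton] at h3
  have h4 := (PadicInt.norm_le_pow_iff_mem_span_pow (p : ℤ_[p]) 2).mpr
    (Ideal.mem_span_singleton.mpr h3)
  rw [PadicInt.norm_p] at h4
  have hp1 : (1 : ℝ) < p := by exact_mod_cast hp.one_lt
  have : (p : ℝ) ^ (-(2 : ℕ) : ℤ) < (p : ℝ)⁻¹ := by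
    rw [← zpow_neg_one]
    exact zpow_lt_zpow_right₀ hp1 (by norm_num)
  linarith

end FourSquares

/-! ### Construction of infinitely many cyclic cubic fields -/

namespace FourSquares

open WeierstrassCurve WeierstrassCurve.Affine Polynomial IntermediateField NumberField

/-- The polynomial `X³ + X² - (3 + 2n) X - n²`, whose roots are the first coordinates of the points
of `y² = x (x + 3) (x - 1)` on the line `y = x + n`. -/
noncomputable def slicePoly (n : ℚ) : ℚ[X] := X ^ 3 + X ^ 2 - C (3 + 2 * n) * X - C (n ^ 2)

theorem slicePoly_natDegree (n : ℚ) : (slicePoly n).natDegree = 3 := by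
  rw [slicePoly]; compute_degree!

theorem slicePoly_monic (n : ℚ) : (slicePoly n).Monic := by
  rw [slicePoly]; monicity!

theorem aeval_slicePoly {A : Type*} [Field A] [Algebra ℚ A] (n : ℚ) (r : A) :
    aeval r (slicePoly n) = r ^ 3 + r ^ 2 - (3 + 2 * (n : A)) * r - (n : A) ^ 2 := by
  simp [slicePoly]

theorem sliceDisc_cast {A : Type*} [Field A] [CharZero A] (n : ℚ) :
    ((sliceDisc n : ℚ) : A) = sliceDisc (n : A) := by
  simp only [sliceDisc]; push_cast; ring

/-- A rational root would produce a rational point of infinite order on E. -/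
theorem slicePoly_irreducible {n d : ℚ} (hd : d ^ 2 = sliceDisc n) (hd0 : d ≠ 0)
    (hn : padicAbv (Rat.castHom ℚ_[2]) (n + 1) < padicAbv (Rat.castHom ℚ_[2]) 8)
    (hn0 : n + 1 ≠ 0) : Irreducible (slicePoly n) := by
  rw [(slicePoly_monic n).irreducible_iff_roots_eq_zero_of_degree_le_three
    (by rw [slicePoly_natDegree]; norm_num) (slicePoly_natDegree n).le]
  refine Multiset.eq_zero_of_forall_notMem fun r hr => ?_
  have hr' : aeval r (slicePoly n) = 0 := by
    rw [mem_roots (slicePoly_monic n).ne_zero] at hr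
    simpa using hr
  rw [aeval_slicePoly] at hr'
  obtain ⟨P, hP⟩ := exists_not_isOfFinAddOrder _ hd hd0 hn hn0 hr'
  exact hP (isOfFinAddOrder_rat P)

theorem exists_cyclicCubic {n d : ℚ} (hd : d ^ 2 = sliceDisc n) (hd0 : d ≠ 0)
    (hn : padicAbv (Rat.castHom ℚ_[2]) (n + 1) < padicAbv (Rat.castHom ℚ_[2]) 8)
    (hn0 : n + 1 ≠ 0) :
    ∃ K : IntermediateField ℚ (AlgebraicClosure ℚ), IsCyclicCubic K ∧ 0 < rankE K ∧
      ∀ (p : ℕ) [Fact p.Prime],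
        padicAbv (Rat.castHom ℚ_[p]) (n + 1) < padicAbv (Rat.castHom ℚ_[p]) 8 →
        Nonempty (K →+* ℚ_[p]) := by
  classical
  have hirr := slicePoly_irreducible hd hd0 hn hn0
  have hmonic := slicePoly_monic n
  obtain ⟨α, hα⟩ := IsAlgClosed.exists_aeval_eq_zero (AlgebraicClosure ℚ) (slicePoly n)
    (by rw [degree_eq_natDegree hmonic.ne_zero, slicePoly_natDegree]; norm_num)
  have hint : IsIntegral ℚ α := ⟨_, hmonic, hα⟩
  have hmin : minpoly ℚ α = slicePoly n := (minpoly.eq_of_irreducible_of_monic hirr hα hmonic).symm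
  have hdF : ∀ (A : Type) [Field A] [CharZero A], (d : A) ^ 2 = sliceDisc (n : A) := by
    intro A _ _
    rw [← sliceDisc_cast, ← hd]; push_cast; rfl
  let r : ℚ⟮α⟯ := AdjoinSimple.gen ℚ α
  have hr : r ^ 3 + r ^ 2 - (3 + 2 * (n : ℚ⟮α⟯)) * r - (n : ℚ⟮α⟯) ^ 2 = 0 := by
    rw [← aeval_slicePoly, ← hmin]
    exact aeval_gen_minpoly ℚ α
  have hd0' : (d : ℚ⟮α⟯) ≠ 0 := by exact_mod_cast hd0
  have hdegree : Module.finrank ℚ ℚ⟮α⟯ = 3 := by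
    rw [adjoin.finrank hint, hmin, slicePoly_natDegree]
  have hhom : ∀ (p : ℕ) [Fact p.Prime],
      padicAbv (Rat.castHom ℚ_[p]) (n + 1) < padicAbv (Rat.castHom ℚ_[p]) 8 →
      Nonempty (ℚ⟮α⟯ →+* ℚ_[p]) := by
    intro p _ hp
    obtain ⟨θ, hθ⟩ := exists_padic_root (p := p) (n := n) (by simpa [padicAbv_apply] using hp)
    refine ⟨((algHomAdjoinIntegralEquiv ℚ hint).symm ⟨θ, ?_⟩).toRingHom⟩
    rw [mem_aroots, hmin]
    exact ⟨hmonic.ne_zero, by rw [aeval_slicePoly]; exact hθ⟩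
  obtain ⟨s, t, e1, e2, e3⟩ := exists_other_roots (hdF _) hd0' hr
  have hsplit : ((slicePoly n).map (algebraMap ℚ ℚ⟮α⟯)) = (X - C r) * (X - C s) * (X - C t) := by
    have hmap : (slicePoly n).map (algebraMap ℚ ℚ⟮α⟯) =
        X ^ 3 + X ^ 2 - C (3 + 2 * (n : ℚ⟮α⟯)) * X - C ((n : ℚ⟮α⟯) ^ 2) := by
      simp [slicePoly]
    have c1 := congrArg (C : ℚ⟮α⟯ → ℚ⟮α⟯[X]) e1
    have c2 := congrArg (C : ℚ⟮α⟯ → ℚ⟮α⟯[X]) e2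
    have c3 := congrArg (C : ℚ⟮α⟯ → ℚ⟮α⟯[X]) e3
    rw [hmap, ← c3, show 3 + 2 * (n : ℚ⟮α⟯) = -(r * s + r * t + s * t) by rw [e2]; ring]
    simp only [C_neg, C_mul, C_add, C_1] at c1 ⊢
    linear_combination X ^ 2 * c1
  have hgal : IsGalois ℚ ℚ⟮α⟯ := by
    have : (slicePoly n).IsSplittingField ℚ ℚ⟮α⟯ := by
      refine ⟨?_, ?_⟩
      · rw [hsplit]
        exact ((Splits.X_sub_C r).mul (Splits.X_sub_C s)).mul (Splits.X_sub_C t)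
      · rw [eq_top_iff]
        refine (adjoin.powerBasis hint).adjoin_gen_eq_top.ge.trans (Algebra.adjoin_mono (Set.singleton_subset_iff.mpr ?_))
        rw [mem_rootSet]
        refine ⟨hmonic.ne_zero, ?_⟩
        rw [adjoin.powerBasis_gen, ← hmin]
        exact aeval_gen_minpoly ℚ α
    exact IsGalois.of_separable_splitting_field (p := slicePoly n) hirr.separable
  have hfd : FiniteDimensional ℚ ℚ⟮α⟯ := adjoin.finiteDimensional hint
  have : Fact (Nat.Prime 3) := ⟨Nat.prime_three⟩
  refine ⟨ℚ⟮α⟯, ⟨hdegree, hgal, isCyclic_of_prime_card (p := 3) ?_⟩, ?_, hhom⟩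
  · rw [IsGalois.card_aut_eq_finrank, hdegree]
  · obtain ⟨ι⟩ := hhom 2 hn
    refine rankE_pos_iff.mpr ?_
    -- This is the classical instance with which `rankE` is formed.
    let : DecidableEq ℚ⟮α⟯ := fun a b => Classical.propDecidable (a = b)
    refine exists_not_isOfFinAddOrder ι (hdF _) hd0' ?_ (by exact_mod_cast hn0) hr
    simpa [padicAbv_apply, map_ofNat ι 8] using hn

/-- A rational point on the fiber curve gives a line that cuts out a cubic of square discriminant. -/
theorem sliceDisc_of_fiberCurve {x y : ℚ} (h : (fiberCurve ℚ).toAffine.Equation x y)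
    (hx : x ≠ 0) : (32 * y / x ^ 2) ^ 2 = sliceDisc (8 / x - 1) := by
  -- The discriminant is a quartic in n vanishing at -1; `n + 1 = 8 / x` sends this root to infinity
  -- and leaves a cubic in x.
  rw [fiberCurve_equation_iff] at h
  rw [div_pow, mul_pow, h, sliceDisc]
  field_simp
  ring

theorem exists_cyclicCubic_ringHom (S : Finset Nat.Primes) :
    ∃ K : IntermediateField ℚ (AlgebraicClosure ℚ), IsCyclicCubic K ∧ 0 < rankE K ∧
      ∀ p ∈ S, haveI : Fact (p : ℕ).Prime := ⟨p.2⟩; Nonempty (K →+* ℚ_[p]) := by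
  classical
  -- The prime 2 is always included, since irreducibility and positive rank are proved 2-adically.
  obtain ⟨M, hM, hS⟩ := exists_nsmul_reducesToZero_of_finite (insert ⟨2, Nat.prime_two⟩ S)
  have hne := nsmul_fiberPoint_ne_zero hM.ne'
  generalize M • fiberPoint = R at hS hne
  match R with
  | 0 => exact absurd rfl hne
  | .some x y h =>
    simp only [reducesToZero_some] at hS
    have h2 : 1 < padicAbv (Rat.castHom ℚ_[2]) x := hS ⟨2, Nat.prime_two⟩ (Finset.mem_insert_self _ _)
    have hx : x ≠ 0 := by
      rintro rfl
      rw [AbsoluteValue.map_zero] at h2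
      linarith
    have hy : y ≠ 0 := by
      rintro rfl
      have := (isShortIntegral_fiberCurve (Rat.castHom ℚ_[2])).abv_Y_sq h.1 h2
      rw [AbsoluteValue.map_zero] at this
      have : 0 < padicAbv (Rat.castHom ℚ_[2]) x ^ 3 := by positivity
      linarith
    have key : ∀ (p : ℕ) [Fact p.Prime], 1 < padicAbv (Rat.castHom ℚ_[p]) x →
        padicAbv (Rat.castHom ℚ_[p]) (8 / x - 1 + 1) < padicAbv (Rat.castHom ℚ_[p]) 8 := by
      intro p _ hp
      rw [sub_add_cancel, map_div₀]
      exact div_lt_self ((padicAbv _).pos (by norm_num)) hp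
    obtain ⟨K, hK, hrank, hhom⟩ := exists_cyclicCubic (sliceDisc_of_fiberCurve h.1 hx)
      (div_ne_zero (mul_ne_zero (by norm_num) hy) (pow_ne_zero 2 hx)) (key 2 h2)
      (by rw [sub_add_cancel]; exact div_ne_zero (by norm_num) hx)
    refine ⟨K, hK, hrank, fun p hp => ?_⟩
    have : Fact (p : ℕ).Prime := ⟨p.2⟩
    exact hhom p (key p (hS p (Finset.mem_insert_of_mem hp)))

theorem IsCyclicCubic.numberField {K : Type*} [Field K] [Algebra ℚ K] [CharZero K]
    (h : IsCyclicCubic K) : NumberField K where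
  to_finiteDimensional := by
    have := Module.finite_of_finrank_pos (R := ℚ) (M := K) (by rw [h.degree]; norm_num)
    convert this
    exact Subsingleton.elim _ _

theorem infinite_cyclicCubic_rankE_pos :
    {K : IntermediateField ℚ (AlgebraicClosure ℚ) |
      IsCyclicCubic K ∧ 0 < rankE K}.Infinite := by
  classical
  intro hfin
  have hp : ∀ K : IntermediateField ℚ (AlgebraicClosure ℚ), ∃ p : Nat.Primes, IsCyclicCubic K →
      haveI : Fact (p : ℕ).Prime := ⟨p.2⟩; IsEmpty (K →+* ℚ_[p]) := by
    intro K
    by_cases hK : IsCyclicCubic K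
    · have := hK.numberField
      have := hK.isGalois
      obtain ⟨p, hp⟩ := exists_prime_isEmpty_ringHom K (by rw [hK.degree]; norm_num)
      exact ⟨p, fun _ => hp⟩
    · exact ⟨⟨2, Nat.prime_two⟩, fun h => absurd h hK⟩
  choose p hp using hp
  -- S consists of one obstructing prime for each field of the supposedly finite set.
  obtain ⟨K, hK, hrank, hhom⟩ := exists_cyclicCubic_ringHom (hfin.toFinset.image p)
  have := hhom (p K) (Finset.mem_image_of_mem p (hfin.mem_toFinset.mpr ⟨hK, hrank⟩))
  exact not_isEmpty_iff.mpr this (hp K hK)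

theorem infinite_progressions_iff_of_isCyclicCubic
    {K : IntermediateField ℚ (AlgebraicClosure ℚ)} (hK : IsCyclicCubic K) :
    (progressions K).Infinite ↔ 0 < rankE K :=
  have := hK.numberField
  infinite_progressions_iff

end FourSquares

theorem mainTheorem6 :
    {K : IntermediateField ℚ (AlgebraicClosure ℚ) |
      FourSquares.IsCyclicCubic K ∧ (FourSquares.progressions K).Infinite}.Infinite ∧
    {K : IntermediateField ℚ (AlgebraicClosure ℚ) |
      FourSquares.IsCyclicCubic K ∧ 0 < FourSquares.rankE K}.Infinite ∧
    ∀ K : IntermediateField ℚ (AlgebraicClosure ℚ), FourSquares.IsCyclicCubic K →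
      ((FourSquares.progressions K).Infinite ↔ 0 < FourSquares.rankE K) := by
  refine ⟨?_, FourSquares.infinite_cyclicCubic_rankE_pos,
    fun K hK => FourSquares.infinite_progressions_iff_of_isCyclicCubic hK⟩
  refine FourSquares.infinite_cyclicCubic_rankE_pos.mono ?_
  rintro K ⟨hK, hrank⟩
  exact ⟨hK, (FourSquares.infinite_progressions_iff_of_isCyclicCubic hK).mpr hrank⟩
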